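/- Let $\Omega\subset\mathbb R^n$ be open, $\delta>0$, $I_\delta=(-\delta,\delta)$, $I_\delta^+=(0,\delta)$, $I_\delta^-=(-\delta,0)$, $\Omega_\delta=I_\delta\times\Omega$ and $\Omega_\delta^\pm=I_\delta^\pm\times\Omega$. Let $X=a(t,x)\partial_t+\sum_{j=1}^n a_j(t,x)\partial_{x_j}$ have coefficients in $C^\infty(\Omega_\delta)$, with $a(0,x)=0$ for all $x\in\Omega$, so that $t=0$ is characteristic. Let $X^*\varphi=-\partial_t(a\varphi)-\sum_j\partial_{x_j}(a_j\varphi)$ be the formal transpose of $X$. (1) Let $b,f\in C^\infty(\Omega_\delta)$, and let $u^\pm\in C^\infty(\Omega_\delta^\pm)$ satisfy $Xu^\pm+bu^\pm=f$ in $\Omega_\delta^\pm$. Suppose that $u^\pm\in L^1(I_\delta^\pm\times K)$ for every compact $K\subset\Omega$, and that $$\lim_{t\to0^\pm}\int_{\mathbb R^n}a(t,x)u^\pm(t,x)\varphi(t,x)\,dx=0\qquad\text{for all }\varphi\in C_0^\infty(\Omega_\delta).$$ Then the function $u$ that equals $u^+$ in $\Omega_\delta^+$ and $u^-$ in $\Omega_\delta^-$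 belongs to $L^1_{loc}(\Omega_\delta)$, and to $L^1(I_\delta\times K)$ for every compact $K\subset\Omega$, and it is a distributional solution of $Xu+bu=f$ in $\Omega_\delta$, i.e. $\int_{\Omega_\delta}u\,(X^*\varphi+b\varphi)\,dt\,dx=\int_{\Omega_\delta}f\varphi\,dt\,dx$ for all $\varphi\in C_0^\infty(\Omega_\delta)$. (2) Let $\Omega=\mathbb R^n$, $s_1,s_2\in\mathbb R$, and let $H^{s_1,s_2}=H^{s_1,s_2}(\mathbb R^n)$ be the space of all $v\in\mathcal S'(\mathbb R^n)$ with $\|v\|_{s_1,s_2}=\|\langle x\rangle^{s_2}\langle D\rangle^{s_1}v\|_{L^2}<\infty$, where $\langle x\rangle=(1+|x|^2)^{1/2}$. Let $b$ be either a function in $C^\infty(I_\delta\times\mathbb R^n)$, or a pseudodifferential operator $b(t,x,D)$ of order zero in $x$ depending smoothly on $t\in I_\delta$: its symbol $b(t,x,\xi)$ is smooth, and for all $k,\alpha,\beta$ one has $|\partial_t^k\partial_x^\alpha\partial_\xi^\beta b(t,x,\xi)|\le C\langle x\rangle^{-|\alpha|}\langle\xi\rangle^{-|\beta|}$, uniformly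 for $t$ in compact subsets of $I_\delta$. Let $b^*$ be its transpose in $x$. For an interval $I\subset I_\delta$, a curve $u$ in $H^{s_1,s_2}$ is called a distributional solution of $Xu+bu=f$ in $I\times\mathbb R^n$ if $$\int_I\langle u(t),(X^*\varphi)(t,\cdot)+b^*(t)\varphi(t,\cdot)\rangle\,dt=\int_I\langle f(t),\varphi(t,\cdot)\rangle\,dt\qquad\text{for all }\varphi\in C_0^\infty(I\times\mathbb R^n).$$ Let $f\in C(I_\delta:H^{s_1,s_2})$, and let $u^\pm\in C(I_\delta^\pm:H^{s_1,s_2})\cap L^1(I_\delta^\pm:H^{s_1,s_2})$ be distributional solutions of $Xu^\pm+bu^\pm=f$ in $I_\delta^\pm\times\mathbb R^n$ such that $$\lim_{t\to0^\pm}\langle u^\pm(t),a(t,\cdot)\varphi(t,\cdot)\rangle=0\qquad\text{for all }\varphi\in C_0^\infty(I_\delta\times\mathbb R^n).$$ Then the curve $u$ that equals $u^+$ for $t>0$ and $u^-$ for $t<0$ belongs to $L^1(I_\delta:H^{s_1,s_2})$ and is a distributional solution of $Xu+bu=f$ in $I_\delta\times\mathbb R^n$. -/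

import Mathlib

open MeasureTheory Set Filter Topology
open scoped ContDiff SchwartzMap FourierTransform

noncomputable section

namespace Gluing

/-- The space `ℝⁿ` of the variable `x`. -/
abbrev E (n : ℕ) : Type := EuclideanSpace ℝ (Fin n)

/-- The domain `I × Ω` in the variables `(t, x)`. -/
def cyl {n : ℕ} (I : Set ℝ) (Ω : Set (E n)) : Set (ℝ × E n) := I ×ˢ Ω

/-- `φ ∈ C₀^∞(W)`. -/
structure IsTest {n : ℕ} (W : Set (ℝ × E n)) (φ : ℝ × E n → ℂ) : Prop where
  smooth : ContDiff ℝ ∞ φ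
  compact : HasCompactSupport φ
  supp : tsupport φ ⊆ W

/-- The partial derivative `∂_t v`. -/
def dt {n : ℕ} (v : ℝ × E n → ℂ) (p : ℝ × E n) : ℂ := fderiv ℝ v p (1, 0)

/-- The partial derivative `∂_{x_j} v`. -/
def dx {n : ℕ} (j : Fin n) (v : ℝ × E n → ℂ) (p : ℝ × E n) : ℂ :=
  fderiv ℝ v p (0, EuclideanSpace.single j 1)

/-- The vector field `X = a ∂_t + ∑_j A_j ∂_{x_j}` acting on functions. -/
def vf {n : ℕ} (a : ℝ × E n → ℂ) (A : Fin n → ℝ × E n → ℂ) (v : ℝ × E n → ℂ)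
    (p : ℝ × E n) : ℂ :=
  a p * dt v p + ∑ j, A j p * dx j v p

/-- The formal transpose `X^* φ = - ∂_t (a φ) - ∑_j ∂_{x_j} (A_j φ)`, with respect to the
bilinear pairing `∫ u φ`. -/
def vfTranspose {n : ℕ} (a : ℝ × E n → ℂ) (A : Fin n → ℝ × E n → ℂ) (φ : ℝ × E n → ℂ)
    (p : ℝ × E n) : ℂ :=
  -dt (fun q => a q * φ q) p - ∑ j, dx j (fun q => A j q * φ q) p

/-- The function equal to `u⁺` for `t > 0` and to `u⁻` for `t < 0` (its value on `t = 0`, a set of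
measure zero, is irrelevant). -/
def glue {n : ℕ} (up um : ℝ × E n → ℂ) (p : ℝ × E n) : ℂ :=
  if 0 < p.1 then up p else if p.1 < 0 then um p else 0

/-- The curve of tempered distributions equal to `u⁺(t)` for `t > 0` and to `u⁻(t)` for `t < 0`. -/
def glueDist {n : ℕ} (up um : ℝ → 𝓢'(E n, ℂ)) (t : ℝ) : 𝓢'(E n, ℂ) :=
  if 0 < t then up t else if t < 0 then um t else 0

/-- `u` is a distributional solution of `X u + b u = f` in the open set `W`, for functions `u`, `f`
that are locally integrable in `W`. -/
def IsDistSol {n : ℕ} (W : Set (ℝ × E n)) (a : ℝ × E n → ℂ) (A : Fin n → ℝ × E n → ℂ)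
    (b f u : ℝ × E n → ℂ) : Prop :=
  ∀ φ : ℝ × E n → ℂ, IsTest W φ →
    ∫ p in W, u p * (vfTranspose a A φ p + b p * φ p) = ∫ p in W, f p * φ p

/-- The bracket `⟨x⟩ = (1 + ‖x‖²)^{1/2}`. -/
def bracket {n : ℕ} (x : E n) : ℝ := Real.sqrt (1 + ‖x‖ ^ 2)

/-- The operator `⟨x⟩^{s₂} ⟨D⟩^{s₁}` on tempered distributions, where `D = -i ∂_x`. In Mathlib's
normalization of the Fourier transform, `D` is the multiplier `2πξ`. -/
def sobolevOp {n : ℕ} (s₁ s₂ : ℝ) (v : 𝓢'(E n, ℂ)) : 𝓢'(E n, ℂ) :=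
  TemperedDistribution.smulLeftCLM ℂ (fun x : E n => (((1 + ‖x‖ ^ 2) ^ (s₂ / 2) : ℝ) : ℂ))
    (TemperedDistribution.fourierMultiplierCLM ℂ
      (fun ξ : E n => (((1 + (2 * Real.pi) ^ 2 * ‖ξ‖ ^ 2) ^ (s₁ / 2) : ℝ) : ℂ)) v)

/-- `v ∈ H^{s₁,s₂}(ℝⁿ)`, and `g ∈ L²` is the function `⟨x⟩^{s₂} ⟨D⟩^{s₁} v`; so the norm of `v` in
`H^{s₁,s₂}` is `‖g‖`, and `v ↦ g` is a linear isometry of `H^{s₁,s₂}` onto `L²`. -/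
def IsSobolevRep {n : ℕ} (s₁ s₂ : ℝ) (v : 𝓢'(E n, ℂ))
    (g : Lp ℂ 2 (volume : Measure (E n))) : Prop :=
  sobolevOp s₁ s₂ v = Lp.toTemperedDistribution g

/-- `u ∈ C(I : H^{s₁,s₂}(ℝⁿ))`. -/
def ContinuousSobolev {n : ℕ} (I : Set ℝ) (s₁ s₂ : ℝ) (u : ℝ → 𝓢'(E n, ℂ)) : Prop :=
  ∃ g : ℝ → Lp ℂ 2 (volume : Measure (E n)),
    ContinuousOn g I ∧ ∀ t ∈ I, IsSobolevRep s₁ s₂ (u t) (g t)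

/-- `u ∈ L¹(I : H^{s₁,s₂}(ℝⁿ))` (Bochner integrability). -/
def IntegrableSobolev {n : ℕ} (I : Set ℝ) (s₁ s₂ : ℝ) (u : ℝ → 𝓢'(E n, ℂ)) : Prop :=
  ∃ g : ℝ → Lp ℂ 2 (volume : Measure (E n)),
    IntegrableOn g I ∧ ∀ᵐ t ∂(volume.restrict I), IsSobolevRep s₁ s₂ (u t) (g t)

open Classical in
/-- The value `⟨v, g⟩` of a tempered distribution on a Schwartz function `g`, which is given as a
plain function (the value is `0` if `g` is not a Schwartz function). -/
def pair {n : ℕ} (v : 𝓢'(E n, ℂ)) (g : E n → ℂ) : ℂ :=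
  if h : ∃ ψ : 𝓢(E n, ℂ), ⇑ψ = g then v h.choose else 0

/-- The symbols of order zero in `x` that depend smoothly on `t ∈ I`: `σ(t, x, ξ)` is smooth, and
each `∂_t^k ∂_x^α ∂_ξ^β σ` is `O(⟨x⟩^{-|α|} ⟨ξ⟩^{-|β|})`, locally uniformly in `t ∈ I`. -/
structure IsSymbolZero {n : ℕ} (I : Set ℝ) (σ : ℝ → E n → E n → ℂ) : Prop where
  smooth : ContDiffOn ℝ ∞ (fun p : ℝ × E n × E n => σ p.1 p.2.1 p.2.2) (I ×ˢ univ)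
  bound : ∀ k i j : ℕ, ∀ J : Set ℝ, IsCompact J → J ⊆ I → ∃ C : ℝ, ∀ t ∈ J, ∀ x ξ : E n,
    bracket x ^ i * bracket ξ ^ j *
      ‖iteratedDeriv k (fun t' => iteratedFDeriv ℝ i
        (fun x' => iteratedFDeriv ℝ j (fun ξ' => σ t' x' ξ') ξ) x) t‖ ≤ C

/-- The transpose of the pseudodifferential operator `σ(x, D)`,
`σ(x, D) v (x) = (2π)^{-n} ∫ e^{i x·ξ} σ(x, ξ) v̂(ξ) dξ`, with `v̂(ξ) = ∫ e^{-i x·ξ} v(x) dx`.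
It is `σ(x, D)^* φ (y) = (2π)^{-n} ∫ e^{-i y·ξ} (∫ e^{i x·ξ} σ(x, ξ) φ(x) dx) dξ`, which becomes the
formula below after the substitution of `2πξ` for `ξ`. For a symbol of order zero it maps Schwartz
functions to Schwartz functions, and `σ(x, D)` acts on tempered distributions by
`⟨σ(x, D) v, φ⟩ = ⟨v, σ(x, D)^* φ⟩`. -/
def pdoTranspose {n : ℕ} (σ : E n → E n → ℂ) (φ : E n → ℂ) : E n → ℂ :=
  𝓕 (fun ξ : E n => 𝓕⁻ (fun x : E n => σ x ((2 * Real.pi) • ξ) * φ x) ξ)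

/-- The term `b`: a function `b(t, x)`, or a pseudodifferential operator `b(t, x, D)` in `x`. -/
inductive ZeroTerm (n : ℕ) : Type
  | mul (b : ℝ × E n → ℂ) : ZeroTerm n
  | pdo (σ : ℝ → E n → E n → ℂ) : ZeroTerm n

/-- `b ∈ C^∞(I × ℝⁿ)`, or `b` is a pseudodifferential operator of order zero in `x` that depends
smoothly on `t ∈ I`. -/
def ZeroTerm.Admissible {n : ℕ} (I : Set ℝ) : ZeroTerm n → Prop
  | .mul b => ContDiffOn ℝ ∞ b (cyl I univ)
  | .pdo σ => IsSymbolZero I σ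

/-- The transpose `b(t)^*`, acting on functions of `x`. -/
def ZeroTerm.transpose {n : ℕ} (t : ℝ) (g : E n → ℂ) : ZeroTerm n → E n → ℂ
  | .mul b => fun x => b (t, x) * g x
  | .pdo σ => pdoTranspose (σ t) g

/-- `u` is a distributional solution of `X u + b u = f` in `I × ℝⁿ`, for curves `u`, `f` of tempered
distributions: `∫ ⟨u(t), X^* φ(t,·) + b(t)^* φ(t,·)⟩ dt = ∫ ⟨f(t), φ(t,·)⟩ dt` for all test
functions. -/
def IsDistSolCurve {n : ℕ} (I : Set ℝ) (a : ℝ × E n → ℂ) (A : Fin n → ℝ × E n → ℂ)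
    (b : ZeroTerm n) (f u : ℝ → 𝓢'(E n, ℂ)) : Prop :=
  ∀ φ : ℝ × E n → ℂ, IsTest (cyl I univ) φ →
    ∫ t in I, (pair (u t) (fun x => vfTranspose a A φ (t, x)) +
        pair (u t) (b.transpose t (fun x => φ (t, x)))) =
      ∫ t in I, pair (f t) (fun x => φ (t, x))

end Gluing

end

/-! Multiply a test function `φ` by a cutoff `χ(t)` that vanishes near `t = 0` and on one side of
it. The product is a test function on the other side, where the equation holds. Since `X^*(χφ) = χ
X^*φ - χ' a φ` and the zero order term commutes with `χ(t)`, the equation tested with `χφ` is the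
wanted identity weighted by `χ`, plus the error `∫ χ'(t) S(t) dt`, where `S(t)` is the flux `∫ a u φ
dx` or `⟨u(t), a φ(t)⟩`. At scale `ε` the derivative `χ'` is `O(1/ε)` and lives on a set of length
`O(ε)`, so `S(t) → 0` kills the error; the other terms converge by dominated convergence. This is
`integral_eq_of_cutoff`. The two one-sided identities add up, because `t = 0` is a null set.

For functions, the ingredients are integration by parts (`isDistSol_of_classical`), the commutator
formula (`vfTranspose_mul_time`) and Fubini.

For curves, the work is to show that `t ↦ ⟨u(t), Ψ t⟩` is integrable. Through the `L²`
representative of `u(t)` this becomes an `L²` pairing, for which it is enough that `Ψ` is bounded in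
the Schwartz space and weakly measurable (`integrableOn_pairing`). Slices of test functions are
clearly such families. For `b(t, x, D)^* φ` one writes the transpose as the Fourier transform of an
oscillatory integral whose amplitude has compact support in `x`. Integration by parts gives decay in
`ξ`, and each `ξ`-derivative is again an integral of the same type, so the integrals are Schwartz
functions with bounds uniform in `t` (`exists_family_transpose`). -/

noncomputable section

namespace Gluing

set_option maxSynthPendingDepth 3

/-! ### Cutoffs in time and the vanishing of the boundary term -/

/-- The derivative of `Real.smoothTransition` is bounded. -/
theorem exists_bound_deriv_smoothTransition :
    ∃ C : ℝ, 0 ≤ C ∧ ∀ y, |deriv Real.smoothTransition y| ≤ C := by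
  have hc : Continuous (deriv Real.smoothTransition) :=
    (Real.smoothTransition.contDiff (n := 1)).continuous_deriv le_rfl
  obtain ⟨C, hC⟩ := (isCompact_Icc (a := (0 : ℝ)) (b := 1)).exists_bound_of_continuousOn
    hc.continuousOn
  have hC0 : 0 ≤ C := (norm_nonneg _).trans (hC 0 (by simp))
  refine ⟨C, hC0, fun y => ?_⟩
  by_cases hy : y ∈ Icc (0 : ℝ) 1
  · exact hC y hy
  · have : deriv Real.smoothTransition y = 0 := by
      rw [mem_Icc, not_and_or, not_le, not_le] at hy
      rcases hy with hy | hy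
      · have : Real.smoothTransition =ᶠ[𝓝 y] fun _ => 0 := by
          filter_upwards [Iio_mem_nhds hy] with z hz
          exact Real.smoothTransition.zero_of_nonpos (le_of_lt hz)
        rw [this.deriv_eq, deriv_const]
      · have : Real.smoothTransition =ᶠ[𝓝 y] fun _ => 1 := by
          filter_upwards [Ioi_mem_nhds hy] with z hz
          exact Real.smoothTransition.one_of_one_le (le_of_lt hz)
        rw [this.deriv_eq, deriv_const]
    simpa [this] using hC0

/-- The cutoff that vanishes for `s t ≤ ε` and equals `1` for `s t ≥ 2 ε`. -/
def cutoff (s ε t : ℝ) : ℝ := Real.smoothTransition (s * t / ε - 1)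

theorem contDiff_cutoff (s ε : ℝ) : ContDiff ℝ ∞ (cutoff s ε) := by
  unfold cutoff
  exact (Real.smoothTransition.contDiff (n := ⊤)).comp
    (((contDiff_const.mul contDiff_id).div_const _).sub contDiff_const)

theorem cutoff_eq_zero {s ε t : ℝ} (hε : 0 < ε) (h : s * t ≤ ε) : cutoff s ε t = 0 := by
  apply Real.smoothTransition.zero_of_nonpos
  have := (div_le_one hε).2 h
  linarith

theorem cutoff_eq_one {s ε t : ℝ} (hε : 0 < ε) (h : 2 * ε ≤ s * t) : cutoff s ε t = 1 := by
  apply Real.smoothTransition.one_of_one_le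
  have := (le_div_iff₀ hε).2 h
  linarith

theorem abs_cutoff_le_one (s ε t : ℝ) : |cutoff s ε t| ≤ 1 := by
  unfold cutoff
  rw [abs_of_nonneg (Real.smoothTransition.nonneg _)]
  exact Real.smoothTransition.le_one _

theorem deriv_cutoff (s ε t : ℝ) :
    deriv (cutoff s ε) t = deriv Real.smoothTransition (s * t / ε - 1) * (s / ε) := by
  have h1 : HasDerivAt (fun t : ℝ => s * t / ε - 1) (s / ε) t := by
    simpa using ((((hasDerivAt_id t).const_mul s).div_const ε).sub_const 1)
  have h2 : HasDerivAt Real.smoothTransition (deriv Real.smoothTransition (s * t / ε - 1))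
      (s * t / ε - 1) :=
    ((Real.smoothTransition.contDiff (n := 1)).differentiable one_ne_zero _).hasDerivAt
  exact (h2.comp t h1).deriv

theorem deriv_cutoff_eq_zero {s ε t : ℝ} (hε : 0 < ε) (h : 2 * ε < s * t) :
    deriv (cutoff s ε) t = 0 := by
  have : cutoff s ε =ᶠ[𝓝 t] fun _ => 1 := by
    have : ∀ᶠ z in 𝓝 t, 2 * ε < s * z :=
      (continuous_const.mul continuous_id).continuousAt.eventually (lt_mem_nhds h)
    filter_upwards [this] with z hz
    exact cutoff_eq_one hε hz.le
  rw [this.deriv_eq, deriv_const]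

/-- If an identity `∫ (χ P - χ' S) = ∫ χ R` holds for all cutoffs `χ` that vanish near the end point
`0` of a half line, and if `S` tends to `0` at the end point, then `∫ P = ∫ R`. -/
theorem integral_eq_of_cutoff {I : Set ℝ} (hI : MeasurableSet I) {s : ℝ} (hs : |s| = 1)
    (hIs : ∀ t ∈ I, 0 < s * t) {P R S : ℝ → ℂ} (hP : IntegrableOn P I) (hR : IntegrableOn R I)
    (hS : IntegrableOn S I) (hS0 : Tendsto S (𝓝[I] 0) (𝓝 0))
    (h : ∀ χ : ℝ → ℝ, ContDiff ℝ ∞ χ → (∃ ε > 0, ∀ t, s * t ≤ ε → χ t = 0) →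
      ∫ t in I, ((χ t : ℂ) * P t - ((deriv χ t : ℝ) : ℂ) * S t) = ∫ t in I, (χ t : ℂ) * R t) :
    ∫ t in I, P t = ∫ t in I, R t := by
  obtain ⟨C, hC0, hC⟩ := exists_bound_deriv_smoothTransition
  set e : ℕ → ℝ := fun k => 1 / ((k : ℝ) + 1) with he
  have he0 : ∀ k, 0 < e k := fun k => Nat.one_div_pos_of_nat
  have helim : Tendsto e atTop (𝓝 0) := tendsto_one_div_add_atTop_nhds_zero_nat
  have hχc : ∀ k, Continuous (cutoff s (e k)) := fun k => (contDiff_cutoff _ _).continuous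
  have hχ'c : ∀ k, Continuous (deriv (cutoff s (e k))) := fun k =>
    (contDiff_cutoff _ _).continuous_deriv (by simp)
  have hχ'b : ∀ k t, |deriv (cutoff s (e k)) t| ≤ C / e k := by
    intro k t
    rw [deriv_cutoff, abs_mul, abs_div, hs, abs_of_pos (he0 k), mul_one_div]
    gcongr
    exact hC _
  -- pointwise convergence of the cutoffs
  have hlim : ∀ t ∈ I, ∀ᶠ k in atTop, cutoff s (e k) t = 1 := by
    intro t ht
    have h1 : Tendsto (fun k => 2 * e k) atTop (𝓝 0) := by simpa using helim.const_mul 2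
    filter_upwards [h1.eventually (gt_mem_nhds (hIs t ht))] with k hk
    exact cutoff_eq_one (he0 k) hk.le
  have hdom : ∀ Q : ℝ → ℂ, IntegrableOn Q I →
      Tendsto (fun k => ∫ t in I, (cutoff s (e k) t : ℂ) * Q t) atTop (𝓝 (∫ t in I, Q t)) := by
    intro Q hQ
    apply tendsto_integral_of_dominated_convergence (fun t => ‖Q t‖)
    · intro k
      exact (Complex.continuous_ofReal.comp (hχc k)).aestronglyMeasurable.mul
        hQ.aestronglyMeasurable
    · exact hQ.norm
    · intro k
      refine Eventually.of_forall fun t => ?_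
      rw [norm_mul, Complex.norm_real, Real.norm_eq_abs]
      exact mul_le_of_le_one_left (norm_nonneg _) (abs_cutoff_le_one _ _ _)
    · filter_upwards [ae_restrict_mem hI] with t ht
      apply tendsto_const_nhds.congr'
      filter_upwards [hlim t ht] with k hk
      simp [hk]
  have hmulint : ∀ k, ∀ Q : ℝ → ℂ, IntegrableOn Q I →
      IntegrableOn (fun t => (cutoff s (e k) t : ℂ) * Q t) I := by
    intro k Q hQ
    refine hQ.bdd_mul (c := 1) ((Complex.continuous_ofReal.comp (hχc k)).aestronglyMeasurable) ?_
    refine Eventually.of_forall fun t => ?_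
    simpa using abs_cutoff_le_one s (e k) t
  have hSint : ∀ k, IntegrableOn (fun t => ((deriv (cutoff s (e k)) t : ℝ) : ℂ) * S t) I := by
    intro k
    refine hS.bdd_mul (c := C / e k)
      ((Complex.continuous_ofReal.comp (hχ'c k)).aestronglyMeasurable) ?_
    refine Eventually.of_forall fun t => ?_
    simpa using hχ'b k t
  -- the boundary term
  have hbd : Tendsto (fun k => ∫ t in I, ((deriv (cutoff s (e k)) t : ℝ) : ℂ) * S t) atTop
      (𝓝 0) := by
    rw [Metric.tendsto_atTop]
    intro η hη
    -- The derivative of the cutoff is at most `C / e k` and acts inside an interval of length `4 *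
    -- e k`, so the integral is at most `4 * C * η'`; the `+ 1` makes the inequality strict and
    -- covers `C = 0`.
    set η' : ℝ := η / (4 * C + 1) with hη'
    have hη'0 : 0 < η' := by positivity
    have h1 : ∀ᶠ t in 𝓝[I] 0, ‖S t‖ < η' := by
      have := hS0.norm
      rw [norm_zero] at this
      exact this.eventually (gt_mem_nhds hη'0)
    rw [eventually_nhdsWithin_iff, Metric.eventually_nhds_iff] at h1
    obtain ⟨r, hr, hr'⟩ := h1
    have h2 : Tendsto (fun k => 2 * e k) atTop (𝓝 0) := by simpa using helim.const_mul 2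
    obtain ⟨N, hN⟩ := eventually_atTop.1 (h2.eventually (gt_mem_nhds hr))
    refine ⟨N, fun k hk => ?_⟩
    have hk' := hN k hk
    rw [dist_zero_right]
    have hzero : ∀ t ∈ I \ (I ∩ Icc (-(2 * e k)) (2 * e k)),
        ((deriv (cutoff s (e k)) t : ℝ) : ℂ) * S t = 0 := by
      rintro t ⟨htI, ht⟩
      have : 2 * e k < s * t := by
        by_contra hcon
        apply ht
        refine ⟨htI, abs_le.1 ?_⟩
        have h3 : |t| = s * t := by
          rw [← abs_of_pos (hIs t htI), abs_mul, hs, one_mul]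
        rw [h3]; exact not_lt.1 hcon
      rw [deriv_cutoff_eq_zero (he0 k) this]; simp
    rw [setIntegral_eq_of_subset_of_forall_sdiff_eq_zero hI inter_subset_left hzero]
    have hfin : volume (I ∩ Icc (-(2 * e k)) (2 * e k)) < ⊤ :=
      (measure_mono inter_subset_right).trans_lt (by simp [Real.volume_Icc])
    have hb : ∀ t ∈ I ∩ Icc (-(2 * e k)) (2 * e k),
        ‖((deriv (cutoff s (e k)) t : ℝ) : ℂ) * S t‖ ≤ C / e k * η' := by
      rintro t ⟨htI, ht⟩
      rw [norm_mul, Complex.norm_real, Real.norm_eq_abs]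
      refine mul_le_mul (hχ'b k t) (hr' ?_ htI).le (norm_nonneg _)
        (div_nonneg hC0 (he0 k).le)
      rw [dist_zero_right, Real.norm_eq_abs]
      exact (abs_le.2 ht).trans_lt hk'
    refine (norm_setIntegral_le_of_norm_le_const hfin hb).trans_lt ?_
    have hvol : volume.real (I ∩ Icc (-(2 * e k)) (2 * e k)) ≤ 4 * e k := by
      refine (measureReal_mono inter_subset_right (by simp [Real.volume_Icc])).trans ?_
      rw [Real.volume_real_Icc_of_le (by linarith [he0 k])]
      linarith
    calc C / e k * η' * volume.real (I ∩ Icc (-(2 * e k)) (2 * e k))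
        ≤ C / e k * η' * (4 * e k) := by
          gcongr
      _ = 4 * C * η' := by field_simp [(he0 k).ne']
      _ < (4 * C + 1) * η' := by linarith
      _ = η := by rw [hη']; field_simp
  have hk : ∀ k, (∫ t in I, (cutoff s (e k) t : ℂ) * P t) -
      ∫ t in I, ((deriv (cutoff s (e k)) t : ℝ) : ℂ) * S t =
      ∫ t in I, (cutoff s (e k) t : ℂ) * R t := by
    intro k
    rw [← integral_sub (hmulint k P hP) (hSint k)]
    exact h _ (contDiff_cutoff _ _) ⟨e k, he0 k, fun t ht => cutoff_eq_zero (he0 k) ht⟩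
  have hl := (hdom P hP).sub hbd
  simp only [hk, sub_zero] at hl
  exact tendsto_nhds_unique hl (hdom R hR)

/-! ### Duality between weighted Sobolev spaces and `L²` -/

/-- The bilinear pairing `(ψ, g) ↦ ∫ ψ g` on `L²`. -/
def pairingL2 (n : ℕ) :
    Lp ℂ 2 (volume : Measure (E n)) →L[ℂ] Lp ℂ 2 (volume : Measure (E n)) →L[ℂ] ℂ :=
  (ContinuousLinearMap.lsmul ℂ ℂ).lpPairing volume 2 2

theorem pairingL2_toLp {n : ℕ} (ψ : 𝓢(E n, ℂ)) (g : Lp ℂ 2 (volume : Measure (E n))) :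
    pairingL2 n (ψ.toLp 2) g = Lp.toTemperedDistribution g ψ := by
  rw [pairingL2, ContinuousLinearMap.lpPairing_eq_integral, Lp.toTemperedDistribution_apply]
  apply integral_congr_ae
  filter_upwards [ψ.coeFn_toLp 2 volume] with x hx
  rw [hx]; rfl

/-- The weight `⟨x⟩^s`. -/
def weight {n : ℕ} (s : ℝ) (x : E n) : ℂ := (((1 + ‖x‖ ^ 2) ^ (s / 2) : ℝ) : ℂ)

/-- The Fourier multiplier symbol of `⟨D⟩^s`. -/
def freqWeight {n : ℕ} (s : ℝ) (ξ : E n) : ℂ :=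
  (((1 + (2 * Real.pi) ^ 2 * ‖ξ‖ ^ 2) ^ (s / 2) : ℝ) : ℂ)

theorem freqWeight_eq {n : ℕ} (s : ℝ) (ξ : E n) :
    freqWeight s ξ = weight s ((2 * Real.pi) • ξ) := by
  rw [freqWeight, weight, norm_smul, mul_pow _ ‖ξ‖, Real.norm_eq_abs, sq_abs]

theorem hasTemperateGrowth_weight {n : ℕ} (s : ℝ) : (weight (n := n) s).HasTemperateGrowth := by
  unfold weight; fun_prop

theorem hasTemperateGrowth_freqWeight {n : ℕ} (s : ℝ) :
    (freqWeight (n := n) s).HasTemperateGrowth := by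
  have h := (hasTemperateGrowth_weight (n := n) s).comp
    ((2 * Real.pi) • ContinuousLinearMap.id ℝ (E n)).hasTemperateGrowth
  convert h using 1
  ext ξ
  simp [freqWeight_eq]

theorem weight_mul_weight_neg {n : ℕ} (s : ℝ) : weight (n := n) s * weight (-s) = fun _ => 1 := by
  ext x
  simp only [weight, Pi.mul_apply]
  rw [← Complex.ofReal_mul, ← Real.rpow_add (by positivity)]
  simp [neg_div]

theorem freqWeight_mul_freqWeight_neg {n : ℕ} (s : ℝ) :
    freqWeight (n := n) s * freqWeight (-s) = fun _ => 1 := by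
  ext x
  rw [Pi.mul_apply, freqWeight_eq, freqWeight_eq]
  exact congrFun (weight_mul_weight_neg s) _

/-- The transpose of the inverse of `⟨x⟩^{s₂} ⟨D⟩^{s₁}`, on Schwartz functions. -/
def sobolevInvTranspose {n : ℕ} (s₁ s₂ : ℝ) : 𝓢(E n, ℂ) →L[ℂ] 𝓢(E n, ℂ) :=
  SchwartzMap.smulLeftCLM ℂ (weight (-s₂)) ∘L FourierTransform.fourierCLM ℂ 𝓢(E n, ℂ) ∘L
    SchwartzMap.smulLeftCLM ℂ (freqWeight (-s₁)) ∘L FourierTransform.fourierInvCLM ℂ 𝓢(E n, ℂ)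

/-- Multiplication and the Fourier transform act on distributions by transposition, so the factors
appear on the Schwartz side in reverse order, and the identity is definitional. -/
theorem sobolevInvTranspose_dual {n : ℕ} (s₁ s₂ : ℝ) (v : 𝓢'(E n, ℂ)) (ψ : 𝓢(E n, ℂ)) :
    v (sobolevInvTranspose s₁ s₂ ψ) =
      TemperedDistribution.fourierMultiplierCLM ℂ (freqWeight (-s₁))
        (TemperedDistribution.smulLeftCLM ℂ (weight (-s₂)) v) ψ := rfl

/-- The weights of exponents `s` and `-s` are inverse to each other, so `v` is recovered from `g`.
This makes the pairing continuous in `g` for the `L²` norm. -/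
theorem IsSobolevRep.apply_eq {n : ℕ} {s₁ s₂ : ℝ} {v : 𝓢'(E n, ℂ)}
    {g : Lp ℂ 2 (volume : Measure (E n))} (h : IsSobolevRep s₁ s₂ v g) (ψ : 𝓢(E n, ℂ)) :
    v ψ = pairingL2 n ((sobolevInvTranspose s₁ s₂ ψ).toLp 2) g := by
  rw [pairingL2_toLp, sobolevInvTranspose_dual, ← h]
  change _ = TemperedDistribution.fourierMultiplierCLM ℂ (freqWeight (-s₁))
        (TemperedDistribution.smulLeftCLM ℂ (weight (-s₂))
        (TemperedDistribution.smulLeftCLM ℂ (weight s₂)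
        (TemperedDistribution.fourierMultiplierCLM ℂ (freqWeight s₁) v))) ψ
  rw [TemperedDistribution.smulLeftCLM_smulLeftCLM_apply (hasTemperateGrowth_weight _)
    (hasTemperateGrowth_weight _), weight_mul_weight_neg,
    TemperedDistribution.smulLeftCLM_const, one_smul,
    TemperedDistribution.fourierMultiplierCLM_fourierMultiplierCLM_apply
    (hasTemperateGrowth_freqWeight _) (hasTemperateGrowth_freqWeight _),
    freqWeight_mul_freqWeight_neg, TemperedDistribution.fourierMultiplierCLM_const]
  simp

/-- The inverse operator can be moved onto a Schwartz function `w`. This turns measurability in `L²`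
into the weak measurability of the original family. -/
theorem exists_transpose_sobolevInvTranspose {n : ℕ} (s₁ s₂ : ℝ) (w : 𝓢(E n, ℂ)) :
    ∃ w' : 𝓢(E n, ℂ), ∀ ψ, pairingL2 n ((sobolevInvTranspose s₁ s₂ ψ).toLp 2) (w.toLp 2) =
      ∫ x, ψ x * w' x := by
  refine ⟨SchwartzMap.fourierMultiplierCLM ℂ (freqWeight (-s₁))
    (SchwartzMap.smulLeftCLM ℂ (weight (-s₂)) w), fun ψ => ?_⟩
  have h1 : TemperedDistribution.smulLeftCLM ℂ (weight (-s₂))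
      (SchwartzMap.toTemperedDistributionCLM (E n) ℂ volume w) =
      SchwartzMap.toTemperedDistributionCLM (E n) ℂ volume
        (SchwartzMap.smulLeftCLM ℂ (weight (-s₂)) w) := by
    ext u
    simp [hasTemperateGrowth_weight, mul_comm, mul_left_comm]
  rw [pairingL2_toLp, Lp.toTemperedDistribution_toLp_eq, sobolevInvTranspose_dual, h1,
    TemperedDistribution.fourierMultiplierCLM_toTemperedDistributionCLM_eq
      (hasTemperateGrowth_freqWeight _)]
  exact SchwartzMap.toTemperedDistributionCLM_apply_apply volume _ ψ

/-! ### Bounded, weakly measurable families and integrability of pairings -/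

/-- A family of Schwartz functions that is bounded in the Schwartz space. -/
def BoundedFamily {n : ℕ} (S : Set ℝ) (Ψ : ℝ → 𝓢(E n, ℂ)) : Prop :=
  ∀ k m : ℕ, ∃ C : ℝ, ∀ t ∈ S, ∀ x, ‖x‖ ^ k * ‖iteratedFDeriv ℝ m (Ψ t) x‖ ≤ C

/-- A family of Schwartz functions that is weakly measurable. -/
def WeaklyMeasurableFamily {n : ℕ} (S : Set ℝ) (Ψ : ℝ → 𝓢(E n, ℂ)) : Prop :=
  ∀ w : 𝓢(E n, ℂ), AEStronglyMeasurable (fun t => ∫ x, Ψ t x * w x) (volume.restrict S)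

/-- A continuous seminorm is dominated by finitely many of the defining Schwartz seminorms. -/
theorem BoundedFamily.exists_bound_seminorm {n : ℕ} {S : Set ℝ} {Ψ : ℝ → 𝓢(E n, ℂ)}
    (h : BoundedFamily S Ψ) (q : Seminorm ℂ 𝓢(E n, ℂ)) (hq : Continuous q) :
    ∃ C : ℝ, ∀ t ∈ S, q (Ψ t) ≤ C := by
  obtain ⟨s, C, -, hC⟩ := Seminorm.bound_of_continuous (schwartz_withSeminorms ℂ (E n) ℂ) q hq
  choose c hc using h
  refine ⟨C * ∑ i ∈ s, max (c i.1 i.2) 0, fun t ht => (hC (Ψ t)).trans ?_⟩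
  change (C : ℝ) * _ ≤ _
  gcongr
  refine Seminorm.finset_sup_apply_le (Finset.sum_nonneg fun _ _ => le_max_right _ _) ?_
  intro i hi
  refine le_trans ?_ (Finset.single_le_sum (f := fun i : ℕ × ℕ => max (c i.1 i.2) 0)
    (fun _ _ => le_max_right _ _) hi)
  exact SchwartzMap.seminorm_le_bound ℂ _ _ _ (le_max_right _ _)
    fun x => (hc _ _ t ht x).trans (le_max_left _ _)

theorem BoundedFamily.exists_bound {n : ℕ} {S : Set ℝ} {Ψ : ℝ → 𝓢(E n, ℂ)}
    (h : BoundedFamily S Ψ) {V : Type*} [NormedAddCommGroup V] [NormedSpace ℂ V]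
    (T : 𝓢(E n, ℂ) →L[ℂ] V) : ∃ C : ℝ, ∀ t ∈ S, ‖T (Ψ t)‖ ≤ C :=
  h.exists_bound_seminorm ((normSeminorm ℂ V).comp (T : 𝓢(E n, ℂ) →ₗ[ℂ] V))
    (continuous_norm.comp T.continuous)

theorem BoundedFamily.fourier {n : ℕ} {S : Set ℝ} {Ψ : ℝ → 𝓢(E n, ℂ)}
    (h : BoundedFamily S Ψ) : BoundedFamily S (fun t => 𝓕 (Ψ t)) := by
  intro k m
  let T : 𝓢(E n, ℂ) →L[ℂ] 𝓢(E n, ℂ) := FourierTransform.fourierCLM ℂ 𝓢(E n, ℂ)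
  obtain ⟨C, hC⟩ := h.exists_bound_seminorm
    ((schwartzSeminormFamily ℂ (E n) ℂ (k, m)).comp (T : 𝓢(E n, ℂ) →ₗ[ℂ] 𝓢(E n, ℂ)))
    (((schwartz_withSeminorms ℂ (E n) ℂ).continuous_seminorm (k, m)).comp T.continuous)
  exact ⟨C, fun t ht x => (SchwartzMap.le_seminorm ℂ k m (T (Ψ t)) x).trans (hC t ht)⟩

theorem WeaklyMeasurableFamily.fourier {n : ℕ} {S : Set ℝ} {Ψ : ℝ → 𝓢(E n, ℂ)}
    (h : WeaklyMeasurableFamily S Ψ) : WeaklyMeasurableFamily S (fun t => 𝓕 (Ψ t)) := by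
  intro w
  simpa only [SchwartzMap.integral_fourier_mul_eq] using h (𝓕 w)

/-- A function that is weakly measurable, paired with a strongly measurable one. -/
theorem aestronglyMeasurable_pairing {V W : Type*} [NormedAddCommGroup V] [NormedSpace ℂ V]
    [NormedAddCommGroup W] [NormedSpace ℂ W] {μ : Measure ℝ} (B : V →L[ℂ] W →L[ℂ] ℂ)
    {y : ℝ → V} {g : ℝ → W} (hg : AEStronglyMeasurable g μ)
    (hy : ∀ c : W, AEStronglyMeasurable (fun t => B (y t) c) μ) :
    AEStronglyMeasurable (fun t => B (y t) (g t)) μ := by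
  -- Simple functions reduce by additivity to constants on measurable sets, which is the weak
  -- hypothesis. A general `g` is a pointwise limit of simple functions, and each `B (y t)` is
  -- continuous.
  have hs : ∀ s : SimpleFunc ℝ W, AEStronglyMeasurable (fun t => B (y t) (s t)) μ := by
    intro s
    induction s using SimpleFunc.induction with
    | const c hs =>
      convert (hy c).indicator hs using 1
      ext t
      simp only [SimpleFunc.const_zero, SimpleFunc.coe_piecewise, SimpleFunc.coe_const,
        SimpleFunc.coe_zero, Set.indicator, Set.piecewise]
      split_ifs <;> simp
    | add _ hf hg => 
      simp only [SimpleFunc.coe_add, Pi.add_apply, map_add]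
      exact hf.add hg
  have hlim : AEStronglyMeasurable (fun t => B (y t) (hg.mk g t)) μ := by
    refine aestronglyMeasurable_of_tendsto_ae atTop
      (fun k => hs (hg.stronglyMeasurable_mk.approx k)) (Eventually.of_forall fun t => ?_)
    exact ((B (y t)).continuous.tendsto _).comp (hg.stronglyMeasurable_mk.tendsto_approx t)
  refine hlim.congr ?_
  filter_upwards [hg.ae_eq_mk] with t ht
  rw [ht]

/-- The pairing of an integrable curve in `H^{s₁,s₂}` with a bounded, weakly measurable family of
Schwartz functions is integrable. -/
theorem integrableOn_pairing {n : ℕ} {S : Set ℝ} (hS : MeasurableSet S) {s₁ s₂ : ℝ}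
    {u : ℝ → 𝓢'(E n, ℂ)} (hu : IntegrableSobolev S s₁ s₂ u) {Ψ : ℝ → 𝓢(E n, ℂ)}
    (hb : BoundedFamily S Ψ) (hm : WeaklyMeasurableFamily S Ψ) :
    IntegrableOn (fun t => u t (Ψ t)) S := by
  obtain ⟨g, hg, hug⟩ := hu
  let y : ℝ → Lp ℂ 2 (volume : Measure (E n)) := fun t => (sobolevInvTranspose s₁ s₂ (Ψ t)).toLp 2
  have hmeas : ∀ c, AEStronglyMeasurable (fun t => pairingL2 n (y t) c) (volume.restrict S) := by
    intro c
    -- By density of Schwartz functions in `L²`, measurability need only be tested against those.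
    have hd := SchwartzMap.denseRange_toLpCLM (E := E n) (F := ℂ) (p := 2) (by simp)
      (μ := volume)
    obtain ⟨z, hz, hlim⟩ := mem_closure_iff_seq_limit.1 (hd c)
    choose w hw using hz
    refine aestronglyMeasurable_of_tendsto_ae atTop (f := fun k t => pairingL2 n (y t) (z k)) ?_
      (Eventually.of_forall fun t => ((pairingL2 n (y t)).continuous.tendsto _).comp hlim)
    intro k
    obtain ⟨w', hw'⟩ := exists_transpose_sobolevInvTranspose s₁ s₂ (w k)
    have : ∀ t, pairingL2 n (y t) (z k) = ∫ x, Ψ t x * w' x := by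
      intro t
      rw [← hw k]
      exact hw' (Ψ t)
    simpa only [this] using hm w'
  obtain ⟨C, hC⟩ := hb.exists_bound
    (SchwartzMap.toLpCLM ℂ ℂ 2 volume ∘L sobolevInvTranspose (n := n) s₁ s₂)
  have hint : IntegrableOn (fun t => pairingL2 n (y t) (g t)) S := by
    refine Integrable.mono' (hg.norm.const_mul (‖pairingL2 n‖ * C))
      (aestronglyMeasurable_pairing _ hg.aestronglyMeasurable hmeas) ?_
    filter_upwards [ae_restrict_mem hS] with t ht
    refine ((pairingL2 n).le_opNorm₂ _ _).trans ?_
    gcongr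
    exact hC t ht
  refine hint.congr ?_
  filter_upwards [hug] with t ht
  exact (ht.apply_eq (Ψ t)).symm

/-! ### Symbols with bounded derivatives and amplitudes with compact support in `x` -/

section Amplitude

variable {ι : Type*} {V F F' : Type} [NormedAddCommGroup V] [InnerProductSpace ℝ V]
  [NormedAddCommGroup F] [NormedSpace ℝ F] [NormedAddCommGroup F'] [NormedSpace ℝ F']

/-- A family of symbols `h i (x, ξ)`, all of whose derivatives are bounded, uniformly in `i`. -/
structure IsSymbolFamily (h : ι → V → V → F) : Prop where
  smooth : ∀ i, ContDiff ℝ ∞ (Function.uncurry (h i))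
  bound : ∀ k j : ℕ, ∃ C : ℝ, ∀ i x ξ,
    ‖iteratedFDeriv ℝ k (fun x' => iteratedFDeriv ℝ j (h i x') ξ) x‖ ≤ C

/-- An amplitude: a family of symbols `h i (x, ξ)` supported in `‖x‖ ≤ R`. -/
structure IsAmplitude (R : ℝ) (h : ι → V → V → F) : Prop extends IsSymbolFamily h where
  supp : ∀ i x ξ, R < ‖x‖ → h i x ξ = 0

/-- Induction on `j`, with `F` general because one derivative in `ξ` changes the target to `V →L[ℝ]
F`. -/
theorem contDiff_iteratedFDeriv_uncurry {F : Type} [NormedAddCommGroup F] [NormedSpace ℝ F]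
    {h : V → V → F} (hh : ContDiff ℝ ∞ (Function.uncurry h)) (j : ℕ) :
    ContDiff ℝ ∞ (fun p : V × V => iteratedFDeriv ℝ j (h p.1) p.2) := by
  induction j generalizing F with
  | zero =>
    simp only [iteratedFDeriv_zero_eq_comp, Function.comp_apply]
    exact (continuousMultilinearCurryFin0 ℝ V F).symm.contDiff.comp hh
  | succ j ih =>
    have h1 : ContDiff ℝ ∞ (Function.uncurry fun x ξ => fderiv ℝ (h x) ξ) := by
      refine ContDiff.fderiv (f := fun p : V × V => h p.1) (g := Prod.snd) (m := ∞) ?_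
        contDiff_snd (by simp)
      exact hh.comp ((contDiff_fst.comp contDiff_fst).prodMk contDiff_snd)
    simp only [iteratedFDeriv_succ_eq_comp_right, Function.comp_apply]
    exact (continuousMultilinearCurryRightEquiv' ℝ j V F).symm.contDiff.comp (ih h1)

theorem contDiff_iteratedFDeriv_left {h : V → V → F} (hh : ContDiff ℝ ∞ (Function.uncurry h))
    (j : ℕ) (ξ : V) : ContDiff ℝ ∞ (fun x => iteratedFDeriv ℝ j (h x) ξ) :=
  (contDiff_iteratedFDeriv_uncurry hh j).comp (contDiff_id.prodMk contDiff_const)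

theorem contDiff_right {h : V → V → F} (hh : ContDiff ℝ ∞ (Function.uncurry h)) (x : V) :
    ContDiff ℝ ∞ (h x) :=
  hh.comp (contDiff_const.prodMk contDiff_id)

theorem contDiff_left {h : V → V → F} (hh : ContDiff ℝ ∞ (Function.uncurry h)) (ξ : V) :
    ContDiff ℝ ∞ (fun x => h x ξ) :=
  hh.comp (contDiff_id.prodMk contDiff_const)

theorem IsSymbolFamily.add {h₁ h₂ : ι → V → V → F} (H₁ : IsSymbolFamily h₁)
    (H₂ : IsSymbolFamily h₂) : IsSymbolFamily (fun i x ξ => h₁ i x ξ + h₂ i x ξ) := by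
  refine ⟨fun i => (H₁.smooth i).add (H₂.smooth i), fun k j => ?_⟩
  obtain ⟨C₁, hC₁⟩ := H₁.bound k j
  obtain ⟨C₂, hC₂⟩ := H₂.bound k j
  refine ⟨C₁ + C₂, fun i x ξ => ?_⟩
  have e1 : (fun x' => iteratedFDeriv ℝ j (fun ξ => h₁ i x' ξ + h₂ i x' ξ) ξ) =
      (fun x' => iteratedFDeriv ℝ j (h₁ i x') ξ) + fun x' => iteratedFDeriv ℝ j (h₂ i x') ξ := by
    ext1 x'
    exact iteratedFDeriv_add_apply
      ((contDiff_right (H₁.smooth i) x').contDiffAt.of_le (by exact_mod_cast le_top))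
      ((contDiff_right (H₂.smooth i) x').contDiffAt.of_le (by exact_mod_cast le_top))
  rw [e1, iteratedFDeriv_add_apply
    ((contDiff_iteratedFDeriv_left (H₁.smooth i) j ξ).contDiffAt.of_le (by exact_mod_cast le_top))
    ((contDiff_iteratedFDeriv_left (H₂.smooth i) j ξ).contDiffAt.of_le (by exact_mod_cast le_top))]
  exact (norm_add_le _ _).trans (add_le_add (hC₁ i x ξ) (hC₂ i x ξ))

theorem IsSymbolFamily.fderiv {h : ι → V → V → F} (H : IsSymbolFamily h) :
    IsSymbolFamily (fun i x ξ => _root_.fderiv ℝ (h i x) ξ) := by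
  refine ⟨fun i => ?_, fun k j => ?_⟩
  · refine ContDiff.fderiv (f := fun p : V × V => h i p.1) (g := Prod.snd) (m := ∞) ?_
        contDiff_snd (by simp)
    exact (H.smooth i).comp ((contDiff_fst.comp contDiff_fst).prodMk contDiff_snd)
  · obtain ⟨C, hC⟩ := H.bound k (j + 1)
    refine ⟨C, fun i x ξ => ?_⟩
    refine le_of_eq_of_le ?_ (hC i x ξ)
    have e1 : (fun x' => iteratedFDeriv ℝ (j + 1) (h i x') ξ) =
        (continuousMultilinearCurryRightEquiv' ℝ j V F).symm ∘
          fun x' => iteratedFDeriv ℝ j (fun ξ => _root_.fderiv ℝ (h i x') ξ) ξ := by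
      ext1 x'
      rw [iteratedFDeriv_succ_eq_comp_right]; rfl
    rw [e1, LinearIsometryEquiv.norm_iteratedFDeriv_comp_left]

theorem IsSymbolFamily.comp_smul {h : ι → V → V → F} (H : IsSymbolFamily h) (a : ℝ) :
    IsSymbolFamily (fun i x ξ => h i x (a • ξ)) := by
  refine ⟨fun i => (H.smooth i).comp (contDiff_fst.prodMk (contDiff_snd.const_smul a)),
    fun k j => ?_⟩
  obtain ⟨C, hC⟩ := H.bound k j
  refine ⟨‖a ^ j‖ * C, fun i x ξ => ?_⟩
  have e1 : (fun x' => iteratedFDeriv ℝ j (fun ξ => h i x' (a • ξ)) ξ) =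
      a ^ j • fun x' => iteratedFDeriv ℝ j (h i x') (a • ξ) := by
    ext1 x'
    rw [iteratedFDeriv_comp_const_smul a
      ((contDiff_right (H.smooth i) x').of_le (by exact_mod_cast le_top))]
    rfl
  rw [e1, iteratedFDeriv_const_smul_apply
    ((contDiff_iteratedFDeriv_left (H.smooth i) j _).contDiffAt.of_le (by exact_mod_cast le_top)),
    norm_smul]
  gcongr
  exact hC i x _

theorem iteratedFDeriv_eq_zero_of_supp {R : ℝ} {h : V → V → F}
    (hs : ∀ x ξ, R < ‖x‖ → h x ξ = 0) (k j : ℕ) {x : V} (hx : R < ‖x‖) (ξ : V) :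
    iteratedFDeriv ℝ k (fun x' => iteratedFDeriv ℝ j (h x') ξ) x = 0 := by
  have : (fun x' => iteratedFDeriv ℝ j (h x') ξ) =ᶠ[𝓝 x] fun _ => 0 := by
    filter_upwards [continuous_norm.continuousAt.eventually (lt_mem_nhds hx)] with y hy
    have : h y = fun _ => 0 := by ext1 ξ; exact hs y ξ hy
    rw [this]
    exact congrFun iteratedFDeriv_fun_zero ξ
  rw [(this.iteratedFDeriv ℝ k).eq_of_nhds]
  exact congrFun iteratedFDeriv_fun_zero x

/-- The factor `m` does not depend on `ξ`, so it passes through the `ξ`-derivatives as a fixed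
linear map; the Leibniz rule in `x` then bounds the rest. Outside the ball everything vanishes, so
bounds on `m` are needed only inside. -/
theorem IsSymbolFamily.clm_apply {h : ι → V → V → F} (H : IsSymbolFamily h) {R : ℝ}
    {m : ι → V → F →L[ℝ] F'} (hm : ∀ i, ContDiff ℝ ∞ (m i))
    (hmb : ∀ k : ℕ, ∃ C : ℝ, ∀ i x, ‖x‖ ≤ R → ‖iteratedFDeriv ℝ k (m i) x‖ ≤ C)
    (hs : ∀ i x ξ, R < ‖x‖ → m i x (h i x ξ) = 0) :
    IsAmplitude R (fun i x ξ => m i x (h i x ξ)) := by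
  refine ⟨⟨fun i => ((hm i).comp contDiff_fst).clm_apply (H.smooth i), fun k j => ?_⟩, hs⟩
  choose c hc using hmb
  choose C hC using H.bound
  let B : (F →L[ℝ] F') →L[ℝ] (V [×j]→L[ℝ] F) →L[ℝ] (V [×j]→L[ℝ] F') :=
    ContinuousLinearMap.compContinuousMultilinearMapL ℝ (fun _ : Fin j => V) F F'
  refine ⟨max (‖B‖ * ∑ l ∈ Finset.range (k + 1), (k.choose l : ℝ) * c l * C (k - l) j) 0,
    fun i x ξ => ?_⟩
  rcases lt_or_ge R ‖x‖ with hx | hx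
  · rw [iteratedFDeriv_eq_zero_of_supp (h := fun x ξ => m i x (h i x ξ)) (hs i) k j hx ξ,
      norm_zero]
    exact le_max_right _ _
  · refine le_trans ?_ (le_max_left _ _)
    have e1 : (fun x' => iteratedFDeriv ℝ j (fun ξ => m i x' (h i x' ξ)) ξ) =
        fun x' => B (m i x') (iteratedFDeriv ℝ j (h i x') ξ) := by
      ext1 x'
      exact (m i x').iteratedFDeriv_comp_left (n := j)
        ((contDiff_right (H.smooth i) x').contDiffAt.of_le (by exact_mod_cast le_top)) le_rfl
    rw [e1]
    refine (B.norm_iteratedFDeriv_le_of_bilinear (hm i)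
      (contDiff_iteratedFDeriv_left (H.smooth i) j ξ) x (n := k)
      (by exact_mod_cast le_top)).trans ?_
    gcongr with l hl
    · exact mul_nonneg (Nat.cast_nonneg _) ((norm_nonneg _).trans (hc l i x hx))
    · exact hc l i x hx
    · exact hC _ _ i x ξ

end Amplitude

/-! ### Oscillatory integrals and their Schwartz bounds -/

section Oscillatory

variable {ι : Type*} {V F : Type} [NormedAddCommGroup V] [InnerProductSpace ℝ V]
  [NormedAddCommGroup F] [NormedSpace ℂ F]

/-- The indicator is an integrable majorant that is uniform in `i` and `ξ`. -/
theorem IsAmplitude.norm_le {R : ℝ} {h : ι → V → V → F} (H : IsAmplitude R h) (k : ℕ) :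
    ∃ C : ℝ, 0 ≤ C ∧ ∀ i x ξ, ‖iteratedFDeriv ℝ k (fun x' => h i x' ξ) x‖ ≤
      (Metric.closedBall (0 : V) R).indicator (fun _ => C) x := by
  obtain ⟨C, hC⟩ := H.bound k 0
  refine ⟨max C 0, le_max_right _ _, fun i x ξ => ?_⟩
  have e1 : ‖iteratedFDeriv ℝ k (fun x' => iteratedFDeriv ℝ 0 (h i x') ξ) x‖ =
      ‖iteratedFDeriv ℝ k (fun x' => h i x' ξ) x‖ := by
    have : (fun x' => iteratedFDeriv ℝ 0 (h i x') ξ) =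
        (continuousMultilinearCurryFin0 ℝ V F).symm ∘ fun x' => h i x' ξ := by
      ext1 x'
      rw [iteratedFDeriv_zero_eq_comp]; rfl
    rw [this, LinearIsometryEquiv.norm_iteratedFDeriv_comp_left]
  rw [← e1]
  by_cases hx : x ∈ Metric.closedBall (0 : V) R
  · rw [indicator_of_mem hx]
    exact (hC i x ξ).trans (le_max_left _ _)
  · rw [indicator_of_notMem hx, iteratedFDeriv_eq_zero_of_supp (H.supp i) k 0 (by simpa using hx) ξ,
      norm_zero]

/-- The amplitude of the derivative of the oscillatory integral. -/
def oscDeriv (h : V → V → F) (x ξ : V) : V →L[ℝ] F :=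
  fderiv ℝ (h x) ξ + (innerSL ℝ x).smulRight ((2 * Real.pi * Complex.I : ℂ) • h x ξ)

/-- Differentiating the phase brings down a factor linear in `x`, which is bounded on the support.
Thus amplitudes are stable under differentiation of the integral, with the same `R`. -/
theorem IsAmplitude.oscDeriv {R : ℝ} {h : ι → V → V → F} (H : IsAmplitude R h) :
    IsAmplitude R (fun i => oscDeriv (h i)) := by
  let κ : F →L[ℝ] F := ContinuousLinearMap.lsmul ℝ ℂ (2 * Real.pi * Complex.I : ℂ)
  let M : V →L[ℝ] F →L[ℝ] V →L[ℝ] F :=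
    ((ContinuousLinearMap.compL ℝ F F (V →L[ℝ] F)).flip κ) ∘L
      (ContinuousLinearMap.smulRightL ℝ V F) ∘L (innerSL ℝ)
  have hM : ∀ x y, M x y = (innerSL ℝ x).smulRight ((2 * Real.pi * Complex.I : ℂ) • y) :=
    fun x y => rfl
  have h2 : IsAmplitude R (fun i x ξ => M x (h i x ξ)) := by
    refine H.toIsSymbolFamily.clm_apply (m := fun _ => M) (fun _ => M.contDiff) (fun k => ?_) ?_
    · obtain ⟨p, C, hC⟩ := M.hasTemperateGrowth.2 k
      refine ⟨|C| * (1 + |R|) ^ p, fun _ x hx => (hC x).trans ?_⟩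
      gcongr
      · exact le_abs_self _
      · exact hx.trans (le_abs_self _)
    · intro i x ξ hx
      rw [H.supp i x ξ hx, map_zero]
  refine ⟨H.toIsSymbolFamily.fderiv.add h2.toIsSymbolFamily, fun i x ξ hx => ?_⟩
  have : h i x = fun _ => 0 := by ext1 ξ; exact H.supp i x ξ hx
  simp [Gluing.oscDeriv, this]

variable [FiniteDimensional ℝ V] [MeasurableSpace V] [BorelSpace V]

/-- The oscillatory integral `∫ e^{2πi x·ξ} h(x, ξ) dx`. -/
def osc (h : V → V → F) (ξ : V) : F := 𝓕⁻ (fun x => h x ξ) ξ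

theorem integrable_indicator_closedBall (R C : ℝ) :
    Integrable ((Metric.closedBall (0 : V) R).indicator (fun _ => C)) := by
  rw [integrable_indicator_iff Metric.isClosed_closedBall.measurableSet]
  exact integrableOn_const (isCompact_closedBall _ _).measure_lt_top.ne

theorem IsAmplitude.exists_pow_mul_norm_osc_le {R : ℝ} {h : ι → V → V → F} (H : IsAmplitude R h)
    (k : ℕ) : ∃ C : ℝ, ∀ i ξ, ‖ξ‖ ^ k * ‖osc (h i) ξ‖ ≤ C := by
  choose C hC0 hC using H.norm_le
  let J : ℕ → ℝ := fun p => ∫ v, (Metric.closedBall (0 : V) R).indicator (fun _ => C p) v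
  refine ⟨2 ^ k * ∑ p ∈ Finset.range (0 + 1) ×ˢ Finset.range (k + 1), J p.2, fun i ξ => ?_⟩
  have hsm : ContDiff ℝ ((⊤ : ℕ∞) : WithTop ℕ∞) (fun x => h i x ξ) := contDiff_left (H.smooth i) ξ
  have hint : ∀ p : ℕ, Integrable (fun v => ‖iteratedFDeriv ℝ p (fun x => h i x ξ) v‖) := by
    intro p
    refine (integrable_indicator_closedBall R (C p)).mono'
      (hsm.continuous_iteratedFDeriv (by exact_mod_cast le_top)).norm.aestronglyMeasurable
      (Eventually.of_forall fun x => ?_)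
    rw [norm_norm]
    exact hC p i x ξ
  -- The variable `ξ` occurs in the phase and in the amplitude. It is frozen in the amplitude, and
  -- the Fourier decay estimate for this function of `x` is evaluated at `-ξ`; the bounds are
  -- uniform in the frozen parameter.
  have key := Real.pow_mul_norm_iteratedFDeriv_fourier_le (K := 0) (N := ⊤) hsm (k := 0) (n := k)
    (fun a p ha _ => by
      have : a = 0 := by simpa using ha
      subst this
      simpa using hint p) le_rfl le_top (-ξ)
  rw [norm_neg, norm_iteratedFDeriv_zero, ← Real.fourierInv_eq_fourier_neg] at key
  refine key.trans ?_
  simp only [pow_zero, one_mul, CharP.cast_eq_zero, mul_zero, zero_add]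
  gcongr with p hp
  have hp0 : p.1 = 0 := by simpa using (Finset.mem_product.1 hp).1
  rw [hp0]
  simp only [pow_zero, one_mul]
  exact integral_mono (hint _) (integrable_indicator_closedBall R (C _)) fun x => hC _ i x ξ

/-- Differentiation under the integral sign, with the majorant of `IsAmplitude.norm_le` for the
differentiated amplitude. -/
theorem IsAmplitude.hasFDerivAt_osc {R : ℝ} {h : ι → V → V → F} (H : IsAmplitude R h) (i : ι)
    (ξ : V) : HasFDerivAt (osc (h i)) (osc (Gluing.oscDeriv (h i)) ξ) ξ := by
  have H' := H.oscDeriv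
  obtain ⟨C, hC0, hC⟩ := H.norm_le 0
  obtain ⟨C', hC'0, hC'⟩ := H'.norm_le 0
  simp only [norm_iteratedFDeriv_zero] at hC hC'
  have he : osc (h i) = fun w => ∫ v : V,
      Complex.exp (↑(2 * Real.pi * inner ℝ v w) * Complex.I) • h i v w := by
    ext1 w
    exact Real.fourierInv_eq' _ _
  have he' : osc (Gluing.oscDeriv (h i)) ξ = ∫ v : V,
      Complex.exp (↑(2 * Real.pi * inner ℝ v ξ) * Complex.I) • Gluing.oscDeriv (h i) v ξ :=
    Real.fourierInv_eq' _ _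
  have hexp : ∀ w : V, Continuous fun v : V =>
      Complex.exp (↑(2 * Real.pi * inner ℝ v w) * Complex.I) := fun w => by fun_prop
  have hnorm : ∀ r : ℝ, ‖Complex.exp (↑r * Complex.I)‖ = 1 := Complex.norm_exp_ofReal_mul_I
  rw [he, he']
  have hcont : ∀ w, Continuous fun v : V =>
      Complex.exp (↑(2 * Real.pi * inner ℝ v w) * Complex.I) • h i v w :=
    fun w => (hexp w).smul (contDiff_left (H.smooth i) w).continuous
  refine hasFDerivAt_integral_of_dominated_of_fderiv_le (𝕜 := ℝ) (s := univ)
    (bound := (Metric.closedBall (0 : V) R).indicator (fun _ => C'))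
    (F' := fun w v => Complex.exp (↑(2 * Real.pi * inner ℝ v w) * Complex.I) •
      Gluing.oscDeriv (h i) v w) univ_mem ?_ ?_ ?_ ?_
    (integrable_indicator_closedBall R C') ?_
  · exact Eventually.of_forall fun w => (hcont w).aestronglyMeasurable
  · refine (integrable_indicator_closedBall R C).mono' (hcont ξ).aestronglyMeasurable
      (Eventually.of_forall fun v => ?_)
    rw [norm_smul, hnorm, one_mul]
    exact hC i v ξ
  · exact ((hexp ξ).smul (contDiff_left (H'.smooth i) ξ).continuous).aestronglyMeasurable
  · refine Eventually.of_forall fun v w _ => ?_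
    rw [norm_smul, hnorm, one_mul]
    exact hC' i v w
  · refine Eventually.of_forall fun v w _ => ?_
    have h1 : HasFDerivAt (fun w : V => ((2 * Real.pi * inner ℝ v w : ℝ) : ℂ) * Complex.I)
        (((2 * Real.pi) • innerSL ℝ v).smulRight Complex.I) w := by
      have := (((2 * Real.pi) • innerSL ℝ v).smulRight Complex.I).hasFDerivAt (x := w)
      refine this.congr_of_eventuallyEq (Eventually.of_forall fun z => ?_)
      simp
    have h2 := h1.cexp.smul
      (((contDiff_right (H.smooth i) v).differentiable (by simp) w).hasFDerivAt)
    refine h2.congr_fderiv ?_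
    ext z
    simp [Gluing.oscDeriv]
    module

theorem IsAmplitude.contDiff_osc {F : Type} [NormedAddCommGroup F] [NormedSpace ℂ F] {R : ℝ}
    {h : ι → V → V → F} (H : IsAmplitude R h) (i : ι) : ContDiff ℝ ∞ (osc (h i)) := by
  rw [contDiff_infty]
  intro m
  induction m generalizing F with
  | zero =>
    exact contDiff_zero.2 (continuous_iff_continuousAt.2 fun ξ => (H.hasFDerivAt_osc i ξ).continuousAt)
  | succ m ih =>
    exact contDiff_succ_iff_hasFDerivAt.2 ⟨_, ih H.oscDeriv, H.hasFDerivAt_osc i⟩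

/-- Each derivative is again an oscillatory integral of an amplitude, with values in a larger space,
so induction reduces the claim to the decay estimate without derivatives. -/
theorem IsAmplitude.exists_bound_osc {F : Type} [NormedAddCommGroup F] [NormedSpace ℂ F] {R : ℝ}
    {h : ι → V → V → F} (H : IsAmplitude R h) (k m : ℕ) :
    ∃ C : ℝ, ∀ i ξ, ‖ξ‖ ^ k * ‖iteratedFDeriv ℝ m (osc (h i)) ξ‖ ≤ C := by
  induction m generalizing F with
  | zero => simpa only [norm_iteratedFDeriv_zero] using H.exists_pow_mul_norm_osc_le k
  | succ m ih =>
    obtain ⟨C, hC⟩ := ih H.oscDeriv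
    refine ⟨C, fun i ξ => ?_⟩
    rw [← norm_iteratedFDeriv_fderiv]
    have : fderiv ℝ (osc (h i)) = osc (Gluing.oscDeriv (h i)) := by
      ext1 ξ; exact (H.hasFDerivAt_osc i ξ).fderiv
    rw [this]
    exact hC i ξ

end Oscillatory

/-! ### Calculus of test functions and the transposed vector field -/

section Tests

variable {n : ℕ} {W : Set (ℝ × E n)} {φ ψ : ℝ × E n → ℂ}

/-- At a point of the support `W` is a neighbourhood and `c` is smooth there; near any other point
the product is identically zero. -/
theorem IsTest.mul_left (h : IsTest W φ) (hW : IsOpen W) {c : ℝ × E n → ℂ}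
    (hc : ContDiffOn ℝ ∞ c W) : IsTest W (fun p => c p * φ p) := by
  refine ⟨contDiff_iff_contDiffAt.2 fun p => ?_, h.compact.mul_left,
    (tsupport_mul_subset_right).trans h.supp⟩
  by_cases hp : p ∈ tsupport (fun p => c p * φ p)
  swap
  · exact contDiffAt_const.congr_of_eventuallyEq (notMem_tsupport_iff_eventuallyEq.1 hp)
  have hpW : p ∈ W := h.supp (tsupport_mul_subset_right hp)
  exact (hc.contDiffAt (hW.mem_nhds hpW)).mul h.smooth.contDiffAt

theorem IsTest.add (h₁ : IsTest W φ) (h₂ : IsTest W ψ) : IsTest W (fun p => φ p + ψ p) :=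
  ⟨h₁.smooth.add h₂.smooth, h₁.compact.add h₂.compact,
    (tsupport_add φ ψ).trans (union_subset h₁.supp h₂.supp)⟩

theorem IsTest.neg (h : IsTest W φ) : IsTest W (fun p => -φ p) :=
  ⟨h.smooth.neg, h.compact.neg, by
    have : tsupport (fun p => -φ p) = tsupport φ := by
      simp only [tsupport, Function.support_fun_neg]
    rw [this]; exact h.supp⟩

theorem isTest_zero : IsTest W (fun _ => 0) :=
  ⟨contDiff_const, HasCompactSupport.zero, by simp [tsupport]⟩

theorem IsTest.sum {ι : Type*} (s : Finset ι) {φ : ι → ℝ × E n → ℂ} (h : ∀ i, IsTest W (φ i)) :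
    IsTest W (fun p => ∑ i ∈ s, φ i p) := by
  classical
  induction s using Finset.induction_on with
  | empty => simpa using isTest_zero
  | insert i s hi ih => simpa only [Finset.sum_insert hi] using (h i).add ih

theorem IsTest.fderiv_apply (h : IsTest W φ) (v : ℝ × E n) :
    IsTest W (fun p => fderiv ℝ φ p v) :=
  ⟨(h.smooth.fderiv_right (m := ∞) (by simp)).clm_apply contDiff_const,
    h.compact.fderiv_apply (𝕜 := ℝ) v, (tsupport_fderiv_apply_subset ℝ v).trans h.supp⟩

theorem IsTest.vfTranspose (h : IsTest W φ) (hW : IsOpen W) {a : ℝ × E n → ℂ}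
    {A : Fin n → ℝ × E n → ℂ} (ha : ContDiffOn ℝ ∞ a W) (hA : ∀ j, ContDiffOn ℝ ∞ (A j) W) :
    IsTest W (vfTranspose a A φ) := by
  have h1 := (((h.mul_left hW ha).fderiv_apply (1, 0)).neg).add
    (IsTest.sum Finset.univ fun j =>
      (h.mul_left hW (hA j)).fderiv_apply (0, EuclideanSpace.single j 1)).neg
  simpa only [← sub_eq_add_neg] using! h1

theorem IsTest.mul_time (h : IsTest W φ) {χ : ℝ → ℝ} (hχ : ContDiff ℝ ∞ χ) :
    IsTest W (fun p => (χ p.1 : ℂ) * φ p) :=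
  ⟨(Complex.ofRealCLM.contDiff.comp (hχ.comp contDiff_fst)).mul h.smooth, h.compact.mul_left,
    (tsupport_mul_subset_right).trans h.supp⟩

/-- The support of the product lies in the closed half space `ε ≤ s * p.1`, hence stays away from `t
= 0`. -/
theorem IsTest.mul_time_of_supp {I I' : Set ℝ} {Ω : Set (E n)} (h : IsTest (cyl I Ω) φ)
    {s : ℝ} (hI' : ∀ t ∈ I, 0 < s * t → t ∈ I') {χ : ℝ → ℝ} (hχ : ContDiff ℝ ∞ χ)
    (hχ0 : ∃ ε > 0, ∀ t, s * t ≤ ε → χ t = 0) :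
    IsTest (cyl I' Ω) (fun p => (χ p.1 : ℂ) * φ p) := by
  have h1 := h.mul_time hχ
  refine ⟨h1.smooth, h1.compact, fun p hp => ?_⟩
  obtain ⟨hpI, hpΩ⟩ := h1.supp hp
  obtain ⟨ε, hε, hz⟩ := hχ0
  refine ⟨hI' _ hpI ?_, hpΩ⟩
  have hcl : IsClosed {p : ℝ × E n | ε ≤ s * p.1} :=
    isClosed_le continuous_const (continuous_const.mul continuous_fst)
  refine hε.trans_le (closure_minimal (fun q hq => ?_) hcl hp)
  by_contra hcon
  exact hq (by simp [hz q.1 (not_le.1 hcon).le])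

/-- Only the `t`-derivative falls on `χ`, so the commutator contains just the coefficient `a`: this
is the source of the flux. -/
theorem vfTranspose_mul_time (h : IsTest W φ) (hW : IsOpen W) {a : ℝ × E n → ℂ}
    {A : Fin n → ℝ × E n → ℂ} (ha : ContDiffOn ℝ ∞ a W) (hA : ∀ j, ContDiffOn ℝ ∞ (A j) W)
    {χ : ℝ → ℝ} (hχ : ContDiff ℝ ∞ χ) (p : ℝ × E n) :
    vfTranspose a A (fun q => (χ q.1 : ℂ) * φ q) p =
      (χ p.1 : ℂ) * vfTranspose a A φ p - ((deriv χ p.1 : ℝ) : ℂ) * (a p * φ p) := by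
  have hχ' : HasFDerivAt (fun q : ℝ × E n => (χ q.1 : ℂ))
      (Complex.ofRealCLM ∘L ((ContinuousLinearMap.toSpanSingleton ℝ (deriv χ p.1)) ∘L
        ContinuousLinearMap.fst ℝ ℝ (E n))) p := by
    have h1 : HasFDerivAt χ (ContinuousLinearMap.toSpanSingleton ℝ (deriv χ p.1)) p.1 :=
      (hχ.differentiable (by simp) p.1).hasDerivAt.hasFDerivAt
    exact Complex.ofRealCLM.hasFDerivAt.comp p (h1.comp p hasFDerivAt_fst)
  -- The component `v.1` is `1` for `∂_t` and `0` for each `∂_{x_j}`, so one formula serves both.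
  have key : ∀ (c : ℝ × E n → ℂ), ContDiffOn ℝ ∞ c W → ∀ v : ℝ × E n,
      fderiv ℝ (fun q => c q * ((χ q.1 : ℂ) * φ q)) p v =
        (χ p.1 : ℂ) * fderiv ℝ (fun q => c q * φ q) p v +
          ((v.1 * deriv χ p.1 : ℝ) : ℂ) * (c p * φ p) := by
    intro c hc v
    have h2 := ((h.mul_left hW hc).smooth.differentiable (by simp) p).hasFDerivAt
    have h3 := (hχ'.mul h2).fderiv
    have e : (fun q => c q * ((χ q.1 : ℂ) * φ q)) = (fun q : ℝ × E n => (χ q.1 : ℂ)) *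
        fun q => c q * φ q := by
      ext q; simp only [Pi.mul_apply]; ring
    rw [e, h3]
    simp
    ring
  simp only [vfTranspose, dt, dx, key a ha, fun j => key (A j) (hA j)]
  simp only [Finset.sum_add_distrib, Finset.mul_sum, mul_sub]
  simp
  ring

theorem IsTest.integrable (h : IsTest W φ) : Integrable φ :=
  h.smooth.continuous.integrable_of_hasCompactSupport h.compact

theorem IsTest.eq_zero (h : IsTest W φ) {p : ℝ × E n} (hp : p ∉ W) : φ p = 0 :=
  image_eq_zero_of_notMem_tsupport fun hp' => hp (h.supp hp')

theorem IsTest.integral_fderiv_eq_zero (h : IsTest W φ) (v : ℝ × E n) :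
    ∫ p in W, fderiv ℝ φ p v = 0 := by
  rw [setIntegral_eq_integral_of_forall_compl_eq_zero fun p hp => (h.fderiv_apply v).eq_zero hp]
  have : (volume : Measure (ℝ × E n)).IsAddHaarMeasure :=
    inferInstanceAs ((volume : Measure ℝ).prod (volume : Measure (E n))).IsAddHaarMeasure
  have := integral_mul_fderiv_eq_neg_fderiv_mul_of_integrable (μ := (volume : Measure (ℝ × E n)))
    (f := fun _ => (1 : ℂ)) (g := φ) (v := v) (by simp)
    (by simpa using (h.fderiv_apply v).integrable) (by simpa using h.integrable)
    (fun _ _ => differentiableAt_const _) (fun p _ => h.smooth.differentiable (by simp) p)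
  simpa using this

/-- A classical solution is a distributional solution. -/
theorem isDistSol_of_classical (hW : IsOpen W) {a : ℝ × E n → ℂ}
    {A : Fin n → ℝ × E n → ℂ} (ha : ContDiffOn ℝ ∞ a W) (hA : ∀ j, ContDiffOn ℝ ∞ (A j) W)
    {b f u : ℝ × E n → ℂ} (hb : ContDiffOn ℝ ∞ b W) (hf : ContDiffOn ℝ ∞ f W)
    (hu : ContDiffOn ℝ ∞ u W) (heq : ∀ p ∈ W, vf a A u p + b p * u p = f p) :
    IsDistSol W a A b f u := by
  intro ψ hψ
  have h1 : ∀ c : ℝ × E n → ℂ, ContDiffOn ℝ ∞ c W → IsTest W (fun p => u p * (c p * ψ p)) :=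
    fun c hc => (hψ.mul_left hW hc).mul_left hW hu
  have hT : IsTest W (fun p => u p * (vfTranspose a A ψ p + b p * ψ p)) :=
    ((hψ.vfTranspose hW ha hA).add (hψ.mul_left hW hb)).mul_left hW hu
  have hF : IsTest W (fun p => f p * ψ p) := hψ.mul_left hW hf
  rw [← sub_eq_zero, ← integral_sub hT.integrable.integrableOn hF.integrable.integrableOn]
  -- The difference of the integrands is minus the divergence of the field `u ψ (a, A)`, which has
  -- compact support in `W`.
  have key : ∀ p ∈ W, u p * (vfTranspose a A ψ p + b p * ψ p) - f p * ψ p =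
      -(fderiv ℝ (fun q => u q * (a q * ψ q)) p (1, 0) +
        ∑ j, fderiv ℝ (fun q => u q * (A j q * ψ q)) p (0, EuclideanSpace.single j 1)) := by
    intro p hp
    have hud := ((hu.contDiffAt (hW.mem_nhds hp)).differentiableAt (by simp)).hasFDerivAt
    have h2 : ∀ c : ℝ × E n → ℂ, ContDiffOn ℝ ∞ c W → ∀ v,
        fderiv ℝ (fun q => u q * (c q * ψ q)) p v =
          u p * fderiv ℝ (fun q => c q * ψ q) p v + c p * fderiv ℝ u p v * ψ p := by
      intro c hc v
      have h3 := ((hψ.mul_left hW hc).smooth.differentiable (by simp) p).hasFDerivAt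
      have h4 := (hud.mul h3).fderiv
      change fderiv ℝ (u * fun q => c q * ψ q) p v = _
      rw [h4]
      simp
      ring
    simp only [h2 a ha, fun j => h2 (A j) (hA j)]
    rw [← heq p hp]
    simp only [vfTranspose, vf, dt, dx, Finset.sum_add_distrib, ← Finset.mul_sum,
      ← Finset.sum_mul]
    ring
  rw [setIntegral_congr_fun hW.measurableSet key, integral_neg,
    integral_add ((h1 a ha).fderiv_apply _).integrable.integrableOn
      (IsTest.sum Finset.univ fun j => (h1 (A j) (hA j)).fderiv_apply _).integrable.integrableOn,
    integral_finsetSum _ fun j _ => ((h1 (A j) (hA j)).fderiv_apply _).integrable.integrableOn]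
  simp [(h1 a ha).integral_fderiv_eq_zero, fun j => (h1 (A j) (hA j)).integral_fderiv_eq_zero]

theorem IsTest.exists_norm_le (h : IsTest W φ) : ∃ C, ∀ p, ‖φ p‖ ≤ C :=
  h.compact.exists_bound_of_continuous h.smooth.continuous

end Tests

/-! ### Gluing of smooth solutions -/

section Functions

variable {n : ℕ}

/-- The product of a function in `L¹(I × K)`, for all compact sets `K`, with a test function. -/
theorem IsTest.integrableOn_mul {I J : Set ℝ} {Ω : Set (E n)} {Θ : ℝ × E n → ℂ}
    (h : IsTest (cyl J Ω) Θ) (hI : MeasurableSet I) {u : ℝ × E n → ℂ}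
    (hu : ∀ K : Set (E n), IsCompact K → K ⊆ Ω → IntegrableOn u (cyl I K)) :
    IntegrableOn (fun p => u p * Θ p) (cyl I univ) := by
  set K : Set (E n) := Prod.snd '' tsupport Θ with hK
  have hKc : IsCompact K := h.compact.isCompact.image continuous_snd
  have hKΩ : K ⊆ Ω := by
    rintro _ ⟨p, hp, rfl⟩
    exact (h.supp hp).2
  obtain ⟨C, hC⟩ := h.exists_norm_le
  have h1 : IntegrableOn (fun p => u p * Θ p) (cyl I K) :=
    (hu K hKc hKΩ).mul_bdd h.smooth.continuous.aestronglyMeasurable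
      (Eventually.of_forall hC)
  refine IntegrableOn.of_forall_sdiff_eq_zero h1 (hI.prod MeasurableSet.univ) ?_
  rintro p ⟨hp, hpK⟩
  have : p ∉ tsupport Θ := fun hp' => hpK ⟨hp.1, mem_image_of_mem _ hp'⟩
  rw [image_eq_zero_of_notMem_tsupport this, mul_zero]

theorem setIntegral_cyl_eq {I : Set ℝ} {Ω : Set (E n)} (hI : MeasurableSet I)
    {g : ℝ × E n → ℂ} (hg : ∀ p, p.2 ∉ Ω → g p = 0) :
    ∫ p in cyl I Ω, g p = ∫ p in cyl I univ, g p := by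
  refine (setIntegral_eq_of_subset_of_forall_sdiff_eq_zero (hI.prod MeasurableSet.univ)
    (prod_mono_right (subset_univ _)) ?_).symm
  rintro p ⟨hp, hp'⟩
  exact hg p fun hΩ => hp' ⟨hp.1, hΩ⟩

theorem setIntegral_cyl_univ {I : Set ℝ} {g : ℝ × E n → ℂ} (hg : IntegrableOn g (cyl I univ)) :
    ∫ p in cyl I univ, g p = ∫ t in I, ∫ x, g (t, x) := by
  have := setIntegral_prod (μ := (volume : Measure ℝ)) (ν := (volume : Measure (E n))) g hg
  simpa using! this

theorem integrableOn_integral_of_cyl {I : Set ℝ} {g : ℝ × E n → ℂ}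
    (hg : IntegrableOn g (cyl I univ)) : IntegrableOn (fun t => ∫ x, g (t, x)) I := by
  have h1 : Integrable g (((volume : Measure ℝ).restrict I).prod (volume : Measure (E n))) := by
    have := Measure.prod_restrict (μ := (volume : Measure ℝ)) (ν := (volume : Measure (E n))) I univ
    rw [Measure.restrict_univ] at this
    rw [this]
    exact hg
  exact h1.integral_prod_left

/-- A function that solves the equation on one side of `t = 0`, and whose flux through `t = 0`
vanishes, satisfies the weak form of the equation on this side, for test functions that do not
vanish at `t = 0`. -/
theorem integral_eq_of_flux {δ : ℝ} {Ω : Set (E n)} (hΩ : IsOpen Ω) {a : ℝ × E n → ℂ}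
    {A : Fin n → ℝ × E n → ℂ}
    (ha : ContDiffOn ℝ ∞ a (cyl (Ioo (-δ) δ) Ω))
    (hA : ∀ j, ContDiffOn ℝ ∞ (A j) (cyl (Ioo (-δ) δ) Ω))
    {I : Set ℝ} (hI : IsOpen I) (hIδ : I ⊆ Ioo (-δ) δ) {s : ℝ} (hs : |s| = 1)
    (hIs : ∀ t ∈ I, 0 < s * t) (hsI : ∀ t ∈ Ioo (-δ) δ, 0 < s * t → t ∈ I)
    {b f u : ℝ × E n → ℂ} (hb : ContDiffOn ℝ ∞ b (cyl (Ioo (-δ) δ) Ω))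
    (hf : ContDiffOn ℝ ∞ f (cyl (Ioo (-δ) δ) Ω)) (hu : ContDiffOn ℝ ∞ u (cyl I Ω))
    (heq : ∀ p ∈ cyl I Ω, vf a A u p + b p * u p = f p)
    (hint : ∀ K : Set (E n), IsCompact K → K ⊆ Ω → IntegrableOn u (cyl I K))
    (hflux : ∀ φ : ℝ × E n → ℂ, IsTest (cyl (Ioo (-δ) δ) Ω) φ →
        Tendsto (fun t : ℝ => ∫ x, a (t, x) * u (t, x) * φ (t, x)) (𝓝[I] 0) (𝓝 0))
    {φ : ℝ × E n → ℂ} (hφ : IsTest (cyl (Ioo (-δ) δ) Ω) φ) :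
    ∫ p in cyl I univ, u p * (vfTranspose a A φ p + b p * φ p) =
      ∫ p in cyl I univ, f p * φ p := by
  have hW : IsOpen (cyl (Ioo (-δ) δ) Ω) := isOpen_Ioo.prod hΩ
  have hW' : IsOpen (cyl I Ω) := hI.prod hΩ
  have hsub : cyl I Ω ⊆ cyl (Ioo (-δ) δ) Ω := prod_mono_left hIδ
  have hT : IsTest (cyl (Ioo (-δ) δ) Ω) (fun p => vfTranspose a A φ p + b p * φ p) :=
    (hφ.vfTranspose hW ha hA).add (hφ.mul_left hW hb)
  have hF := hφ.mul_left hW hf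
  have hB := hφ.mul_left hW ha
  have iT := hT.integrableOn_mul hI.measurableSet hint
  have iB := hB.integrableOn_mul hI.measurableSet hint
  have iF : IntegrableOn (fun p => f p * φ p) (cyl I univ) := hF.integrable.integrableOn
  rw [setIntegral_cyl_univ iT, setIntegral_cyl_univ iF]
  refine integral_eq_of_cutoff hI.measurableSet hs hIs (integrableOn_integral_of_cyl iT)
    (integrableOn_integral_of_cyl iF) (integrableOn_integral_of_cyl iB) ?_ ?_
  · refine (hflux φ hφ).congr fun t => ?_
    congr 1 with x
    ring
  · intro χ hχ hχ0
    have hχφ := hφ.mul_time_of_supp hsI hχ hχ0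
    have hweak := isDistSol_of_classical hW' (ha.mono hsub) (fun j => (hA j).mono hsub)
      (hb.mono hsub) (hf.mono hsub) hu heq _ hχφ
    have hχ'c : ContDiff ℝ ∞ (deriv χ) := by
      have := (contDiff_infty_iff_deriv.1 hχ).2
      exact this
    have iχT := (hT.mul_time hχ).integrableOn_mul hI.measurableSet hint
    have iχB := (hB.mul_time hχ'c).integrableOn_mul hI.measurableSet hint
    have iχF : IntegrableOn (fun p => (χ p.1 : ℂ) * (f p * φ p)) (cyl I univ) :=
      (hF.mul_time hχ).integrable.integrableOn
    have hz : ∀ p : ℝ × E n, p.2 ∉ Ω → φ p = 0 := fun p hp => hφ.eq_zero fun h => hp h.2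
    have hzT : ∀ p : ℝ × E n, p.2 ∉ Ω →
        vfTranspose a A (fun q => (χ q.1 : ℂ) * φ q) p = 0 := fun p hp =>
      ((hφ.mul_time hχ).vfTranspose hW ha hA).eq_zero fun h => hp h.2
    -- All integrands vanish for `x` outside `Ω`, so the integrals extend to the whole `x`-space,
    -- where Fubini applies.
    rw [setIntegral_cyl_eq (Ω := Ω) hI.measurableSet fun p hp => by simp [hz p hp, hzT p hp],
      setIntegral_cyl_eq (Ω := Ω) hI.measurableSet fun p hp => by simp [hz p hp]] at hweak
    have e1 : (fun p : ℝ × E n => u p * (vfTranspose a A (fun q => (χ q.1 : ℂ) * φ q) p +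
        b p * ((χ p.1 : ℂ) * φ p))) = fun p =>
        u p * ((χ p.1 : ℂ) * (vfTranspose a A φ p + b p * φ p)) -
          u p * (((deriv χ p.1 : ℝ) : ℂ) * (a p * φ p)) := by
      ext1 p
      rw [vfTranspose_mul_time hφ hW ha hA hχ]
      ring
    have e2 : (fun p : ℝ × E n => f p * ((χ p.1 : ℂ) * φ p)) =
        fun p => (χ p.1 : ℂ) * (f p * φ p) := by
      ext1 p
      ring
    rw [e1, e2, integral_sub iχT iχB, setIntegral_cyl_univ iχT, setIntegral_cyl_univ iχB,
      setIntegral_cyl_univ iχF,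
      ← integral_sub (integrableOn_integral_of_cyl iχT) (integrableOn_integral_of_cyl iχB)] at hweak
    convert hweak using 3 with t t
    · rw [← integral_const_mul, ← integral_const_mul]
      congr 1
      · congr 1 with x
        ring
      · congr 1 with x
        ring
    · rw [← integral_const_mul]

theorem Ioo_ae_eq_union (δ : ℝ) :
    (Ioo (-δ) δ : Set ℝ) =ᵐ[volume] (Ioo 0 δ ∪ Ioo (-δ) 0 : Set ℝ) := by
  have h0 : ∀ᵐ t : ℝ, t ≠ 0 := by
    simp [ae_iff, measure_singleton]
  filter_upwards [h0] with t ht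
  apply propext
  change t ∈ Ioo (-δ) δ ↔ t ∈ Ioo 0 δ ∪ Ioo (-δ) 0
  simp only [mem_union, mem_Ioo]
  constructor
  · rintro ⟨h1, h2⟩
    rcases lt_or_gt_of_ne ht with h | h
    · exact Or.inr ⟨h1, h⟩
    · exact Or.inl ⟨h, h2⟩
  · rintro (⟨h1, h2⟩ | ⟨h1, h2⟩)
    · exact ⟨by linarith, h2⟩
    · exact ⟨h1, by linarith⟩

theorem disjoint_Ioo_zero (δ : ℝ) : Disjoint (Ioo 0 δ) (Ioo (-δ) 0) :=
  Set.disjoint_left.2 fun _ h h' => lt_asymm h.1 h'.2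

theorem cyl_ae_eq_union (δ : ℝ) (K : Set (E n)) :
    cyl (Ioo (-δ) δ) K =ᵐ[volume] (cyl (Ioo 0 δ) K ∪ cyl (Ioo (-δ) 0) K : Set (ℝ × E n)) := by
  have h := Measure.set_prod_ae_eq (μ := (volume : Measure ℝ)) (ν := (volume : Measure (E n)))
    (Ioo_ae_eq_union δ) (ae_eq_refl K)
  rw [union_prod] at h
  exact h

theorem disjoint_cyl (δ : ℝ) (K : Set (E n)) :
    Disjoint (cyl (Ioo 0 δ) K) (cyl (Ioo (-δ) 0) K) :=
  Set.disjoint_left.2 fun _ h h' => lt_asymm h.1.1 h'.1.2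

theorem glue_eq_left {up um : ℝ × E n → ℂ} {δ : ℝ} {K : Set (E n)} {p : ℝ × E n}
    (hp : p ∈ cyl (Ioo 0 δ) K) : glue up um p = up p := by
  have : 0 < p.1 := hp.1.1
  simp [glue, this]

theorem glue_eq_right {up um : ℝ × E n → ℂ} {δ : ℝ} {K : Set (E n)} {p : ℝ × E n}
    (hp : p ∈ cyl (Ioo (-δ) 0) K) : glue up um p = um p := by
  have : p.1 < 0 := hp.1.2
  simp [glue, this, this.le]

theorem integrableOn_glue {δ : ℝ} {up um : ℝ × E n → ℂ} {K : Set (E n)}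
    (hK : MeasurableSet K) (hp : IntegrableOn up (cyl (Ioo 0 δ) K))
    (hm : IntegrableOn um (cyl (Ioo (-δ) 0) K)) :
    IntegrableOn (glue up um) (cyl (Ioo (-δ) δ) K) := by
  have h1 : IntegrableOn (glue up um) (cyl (Ioo 0 δ) K) :=
    hp.congr_fun (fun p h => (glue_eq_left h).symm) (measurableSet_Ioo.prod hK)
  have h2 : IntegrableOn (glue up um) (cyl (Ioo (-δ) 0) K) :=
    hm.congr_fun (fun p h => (glue_eq_right h).symm) (measurableSet_Ioo.prod hK)
  exact (h1.union h2).congr_set_ae (cyl_ae_eq_union δ K)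

/-- Sum of the two one-sided identities `integral_eq_of_flux`, with `s = 1` and `s = -1`. -/
theorem isDistSol_glue {δ : ℝ} (hδ : 0 < δ) {Ω : Set (E n)} (hΩ : IsOpen Ω)
    {a : ℝ × E n → ℂ} {A : Fin n → ℝ × E n → ℂ}
    (ha : ContDiffOn ℝ ∞ a (cyl (Ioo (-δ) δ) Ω))
    (hA : ∀ j, ContDiffOn ℝ ∞ (A j) (cyl (Ioo (-δ) δ) Ω))
    {b f up um : ℝ × E n → ℂ}
    (hb : ContDiffOn ℝ ∞ b (cyl (Ioo (-δ) δ) Ω)) (hf : ContDiffOn ℝ ∞ f (cyl (Ioo (-δ) δ) Ω))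
    (hup : ContDiffOn ℝ ∞ up (cyl (Ioo 0 δ) Ω)) (hum : ContDiffOn ℝ ∞ um (cyl (Ioo (-δ) 0) Ω))
    (eqp : ∀ p ∈ cyl (Ioo 0 δ) Ω, vf a A up p + b p * up p = f p)
    (eqm : ∀ p ∈ cyl (Ioo (-δ) 0) Ω, vf a A um p + b p * um p = f p)
    (ip : ∀ K : Set (E n), IsCompact K → K ⊆ Ω → IntegrableOn up (cyl (Ioo 0 δ) K))
    (im : ∀ K : Set (E n), IsCompact K → K ⊆ Ω → IntegrableOn um (cyl (Ioo (-δ) 0) K))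
    (fp : ∀ φ : ℝ × E n → ℂ, IsTest (cyl (Ioo (-δ) δ) Ω) φ →
        Tendsto (fun t : ℝ => ∫ x, a (t, x) * up (t, x) * φ (t, x)) (𝓝[>] 0) (𝓝 0))
    (fm : ∀ φ : ℝ × E n → ℂ, IsTest (cyl (Ioo (-δ) δ) Ω) φ →
        Tendsto (fun t : ℝ => ∫ x, a (t, x) * um (t, x) * φ (t, x)) (𝓝[<] 0) (𝓝 0)) :
    IsDistSol (cyl (Ioo (-δ) δ) Ω) a A b f (glue up um) := by
  intro φ hφ
  have hW : IsOpen (cyl (Ioo (-δ) δ) Ω) := isOpen_Ioo.prod hΩ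
  have hT : IsTest (cyl (Ioo (-δ) δ) Ω) (fun p => vfTranspose a A φ p + b p * φ p) :=
    (hφ.vfTranspose hW ha hA).add (hφ.mul_left hW hb)
  have hF := hφ.mul_left hW hf
  have hp := integral_eq_of_flux hΩ ha hA isOpen_Ioo
    (Ioo_subset_Ioo_left (by linarith)) (s := 1) (by simp) (fun t ht => by simpa using ht.1)
    (fun t ht h => ⟨by simpa using h, ht.2⟩) hb hf hup eqp ip
    (fun φ hφ => (fp φ hφ).mono_left (nhdsWithin_mono _ fun t ht => ht.1)) hφ
  have hm := integral_eq_of_flux hΩ ha hA isOpen_Ioo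
    (Ioo_subset_Ioo_right hδ.le) (s := -1) (by simp) (fun t ht => by simpa using ht.2)
    (fun t ht h => ⟨ht.1, by simpa using h⟩) hb hf hum eqm im
    (fun φ hφ => (fm φ hφ).mono_left (nhdsWithin_mono _ fun t ht => ht.2)) hφ
  have hz : ∀ p : ℝ × E n, p.2 ∉ Ω → vfTranspose a A φ p + b p * φ p = 0 :=
    fun p hp => hT.eq_zero fun h => hp h.2
  have hz' : ∀ p : ℝ × E n, p.2 ∉ Ω → f p * φ p = 0 :=
    fun p hp => hF.eq_zero fun h => hp h.2
  have hMp : MeasurableSet (cyl (Ioo 0 δ) (univ : Set (E n))) :=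
    measurableSet_Ioo.prod MeasurableSet.univ
  have hMm : MeasurableSet (cyl (Ioo (-δ) 0) (univ : Set (E n))) :=
    measurableSet_Ioo.prod MeasurableSet.univ
  have cp : ∀ p ∈ cyl (Ioo 0 δ) (univ : Set (E n)),
      up p * (vfTranspose a A φ p + b p * φ p) =
        glue up um p * (vfTranspose a A φ p + b p * φ p) := fun p h => by rw [glue_eq_left h]
  have cm : ∀ p ∈ cyl (Ioo (-δ) 0) (univ : Set (E n)),
      um p * (vfTranspose a A φ p + b p * φ p) =
        glue up um p * (vfTranspose a A φ p + b p * φ p) := fun p h => by rw [glue_eq_right h]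
  have iTp := (hT.integrableOn_mul measurableSet_Ioo ip).congr_fun cp hMp
  have iTm := (hT.integrableOn_mul measurableSet_Ioo im).congr_fun cm hMm
  rw [setIntegral_cyl_eq (Ω := Ω) measurableSet_Ioo fun p hp => by rw [hz p hp, mul_zero],
    setIntegral_cyl_eq measurableSet_Ioo hz',
    setIntegral_congr_set (cyl_ae_eq_union δ univ), setIntegral_congr_set (cyl_ae_eq_union δ univ),
    setIntegral_union (disjoint_cyl δ _) hMm iTp iTm,
    setIntegral_union (disjoint_cyl δ _) hMm hF.integrable.integrableOn hF.integrable.integrableOn,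
    ← setIntegral_congr_fun hMp cp, ← setIntegral_congr_fun hMm cm, hp, hm]

theorem locallyIntegrableOn_of_compact {J : Set ℝ} (hJ : IsOpen J) {Ω : Set (E n)} (hΩ : IsOpen Ω)
    {u : ℝ × E n → ℂ}
    (hu : ∀ K : Set (E n), IsCompact K → K ⊆ Ω → IntegrableOn u (cyl J K)) :
    LocallyIntegrableOn u (cyl J Ω) := by
  intro p hp
  obtain ⟨K, hK, hpK, hKΩ⟩ := exists_compact_subset hΩ hp.2
  exact ⟨cyl J K, mem_nhdsWithin_of_mem_nhds
    (prod_mem_nhds (hJ.mem_nhds hp.1) (mem_interior_iff_mem_nhds.1 hpK)), hu K hK hKΩ⟩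

end Functions

/-! ### Gluing of Sobolev-valued solutions -/

section Curves

variable {n : ℕ}

/-- A Schwartz function is determined by its values, so the choice made in `pair` is immaterial. -/
theorem pair_eq {v : 𝓢'(E n, ℂ)} {g : E n → ℂ} {ψ : 𝓢(E n, ℂ)} (h : ⇑ψ = g) :
    pair v g = v ψ := by
  have hex : ∃ ψ : 𝓢(E n, ℂ), ⇑ψ = g := ⟨ψ, h⟩
  rw [pair, dif_pos hex]
  congr 1
  exact DFunLike.coe_injective (hex.choose_spec.trans h.symm)

theorem BoundedFamily.mono {S S' : Set ℝ} {Ψ : ℝ → 𝓢(E n, ℂ)} (h : BoundedFamily S Ψ)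
    (hS : S' ⊆ S) : BoundedFamily S' Ψ := fun k m =>
  let ⟨C, hC⟩ := h k m
  ⟨C, fun t ht => hC t (hS ht)⟩

theorem WeaklyMeasurableFamily.mono {S S' : Set ℝ} {Ψ : ℝ → 𝓢(E n, ℂ)}
    (h : WeaklyMeasurableFamily S Ψ) (hS : S' ⊆ S) : WeaklyMeasurableFamily S' Ψ :=
  fun w => (h w).mono_measure (Measure.restrict_mono hS le_rfl)

theorem BoundedFamily.zero_of_notMem {S J : Set ℝ} {Ψ : ℝ → 𝓢(E n, ℂ)} (h : BoundedFamily J Ψ)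
    (h0 : ∀ t ∉ J, Ψ t = 0) : BoundedFamily S Ψ := by
  intro k m
  obtain ⟨C, hC⟩ := h k m
  refine ⟨max C 0, fun t _ x => ?_⟩
  by_cases ht : t ∈ J
  · exact (hC t ht x).trans (le_max_left _ _)
  · have : iteratedFDeriv ℝ m (⇑(Ψ t)) x = 0 := by
      rw [h0 t ht]
      exact congrFun iteratedFDeriv_fun_zero x
    rw [this, norm_zero, mul_zero]
    exact le_max_right _ _

variable {W : Set (ℝ × E n)} {Θ : ℝ × E n → ℂ}

theorem IsTest.contDiff_slice (h : IsTest W Θ) (t : ℝ) : ContDiff ℝ ∞ (fun x => Θ (t, x)) :=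
  h.smooth.comp (contDiff_const.prodMk contDiff_id)

theorem IsTest.hasCompactSupport_slice (h : IsTest W Θ) (t : ℝ) :
    HasCompactSupport (fun x => Θ (t, x)) := by
  refine HasCompactSupport.intro (h.compact.isCompact.image continuous_snd) fun x hx => ?_
  exact image_eq_zero_of_notMem_tsupport fun hp => hx ⟨_, hp, rfl⟩

/-- The slice `Θ(t, ·)` of a test function, as a Schwartz function. -/
def IsTest.slice (h : IsTest W Θ) (t : ℝ) : 𝓢(E n, ℂ) :=
  (h.hasCompactSupport_slice t).toSchwartzMap (h.contDiff_slice t)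

theorem IsTest.coe_slice (h : IsTest W Θ) (t : ℝ) : ⇑(h.slice t) = fun x => Θ (t, x) := rfl

/-- The `x`-derivatives of a slice are restrictions of the full derivatives of `Θ`, and these,
weighted by a power of `‖x‖`, are continuous with compact support in `(t, x)`. -/
theorem IsTest.exists_bound_slice (h : IsTest W Θ) (k m : ℕ) :
    ∃ C : ℝ, ∀ t x, ‖x‖ ^ k * ‖iteratedFDeriv ℝ m (fun x => Θ (t, x)) x‖ ≤ C := by
  let ι : E n →L[ℝ] ℝ × E n := ContinuousLinearMap.inr ℝ ℝ (E n)
  have hc : Continuous fun p : ℝ × E n => ‖p.2‖ ^ k * ‖iteratedFDeriv ℝ m Θ p‖ :=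
    (continuous_snd.norm.pow k).mul
      (h.smooth.continuous_iteratedFDeriv (by exact_mod_cast le_top)).norm
  have hs : HasCompactSupport fun p : ℝ × E n => ‖p.2‖ ^ k * ‖iteratedFDeriv ℝ m Θ p‖ :=
    (h.compact.iteratedFDeriv (𝕜 := ℝ) m).norm.mul_left
  obtain ⟨C, hC⟩ := hs.exists_bound_of_continuous hc
  refine ⟨C * ‖ι‖ ^ m, fun t x => ?_⟩
  have e1 : (fun x => Θ (t, x)) = (fun p => Θ ((t, 0) + p)) ∘ ι := by
    ext x; simp [ι]
  have hsm : ContDiff ℝ m (fun p => Θ ((t, 0) + p)) :=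
    (h.smooth.comp (contDiff_const.add contDiff_id)).of_le (by exact_mod_cast le_top)
  rw [e1, ι.iteratedFDeriv_comp_right hsm x le_rfl, iteratedFDeriv_comp_add_left]
  refine (mul_le_mul_of_nonneg_left
    (ContinuousMultilinearMap.norm_compContinuousLinearMap_le _ _) (by positivity)).trans ?_
  simp only [Finset.prod_const, Finset.card_univ, Fintype.card_fin]
  rw [← mul_assoc]
  gcongr
  have := (le_abs_self _).trans (hC ((t, 0) + ι x))
  simpa [ι] using this

theorem IsTest.boundedFamily_slice (h : IsTest W Θ) (S : Set ℝ) : BoundedFamily S h.slice :=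
  fun k m => let ⟨C, hC⟩ := h.exists_bound_slice k m; ⟨C, fun t _ x => hC t x⟩

theorem weaklyMeasurableFamily_of_stronglyMeasurable {S : Set ℝ} {Ψ : ℝ → 𝓢(E n, ℂ)}
    {H : ℝ × E n → ℂ} (hH : StronglyMeasurable H) (hS : MeasurableSet S)
    (h : ∀ t ∈ S, ∀ x, Ψ t x = H (t, x)) : WeaklyMeasurableFamily S Ψ := by
  intro w
  have h1 : StronglyMeasurable (fun t => ∫ x, H (t, x) * w x) := by
    refine StronglyMeasurable.integral_prod_right (f := fun t x => H (t, x) * w x) ?_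
    exact hH.mul (w.continuous.comp continuous_snd).stronglyMeasurable
  refine h1.aestronglyMeasurable.congr ?_
  filter_upwards [ae_restrict_mem hS] with t ht
  simp only [h t ht]

theorem IsTest.weaklyMeasurableFamily_slice (h : IsTest W Θ) {S : Set ℝ} (hS : MeasurableSet S) :
    WeaklyMeasurableFamily S h.slice :=
  weaklyMeasurableFamily_of_stronglyMeasurable h.smooth.continuous.stronglyMeasurable hS
    fun _ _ _ => rfl

theorem one_le_bracket (x : E n) : 1 ≤ bracket x := by
  rw [bracket, Real.one_le_sqrt]
  nlinarith [sq_nonneg ‖x‖]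

/-- The weights are at least `1`, so the symbol estimates without `t`-derivatives give plain bounds,
uniform on the compact set `J`. -/
theorem IsSymbolZero.isSymbolFamily {I J : Set ℝ} {σ : ℝ → E n → E n → ℂ} (h : IsSymbolZero I σ)
    (hI : IsOpen I) (hJ : IsCompact J) (hJI : J ⊆ I) :
    IsSymbolFamily (fun (t : J) x ξ => σ t x ξ) := by
  refine ⟨fun t => ?_, fun k j => ?_⟩
  · rw [contDiff_iff_contDiffAt]
    intro p
    have h1 : ContDiffAt ℝ ∞ (fun p : ℝ × E n × E n => σ p.1 p.2.1 p.2.2) ((t : ℝ), p) :=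
      h.smooth.contDiffAt ((hI.prod isOpen_univ).mem_nhds ⟨hJI t.2, trivial⟩)
    exact h1.comp p (contDiffAt_const.prodMk contDiffAt_id)
  · obtain ⟨C, hC⟩ := h.bound 0 k j J hJ hJI
    refine ⟨C, fun t x ξ => le_trans ?_ (hC t t.2 x ξ)⟩
    rw [iteratedDeriv_zero]
    exact le_mul_of_one_le_left (norm_nonneg _)
      (one_le_mul_of_one_le_of_one_le (one_le_pow₀ (one_le_bracket x))
        (one_le_pow₀ (one_le_bracket ξ)))

/-- The times at which a test function does not vanish lie in a compact set. -/
theorem IsTest.exists_compact_time {I : Set ℝ} (h : IsTest (cyl I univ) Θ) :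
    ∃ J : Set ℝ, IsCompact J ∧ J ⊆ I ∧ ∀ t ∉ J, ∀ x, Θ (t, x) = 0 := by
  refine ⟨Prod.fst '' tsupport Θ, h.compact.isCompact.image continuous_fst, ?_, ?_⟩
  · rintro _ ⟨p, hp, rfl⟩
    exact (h.supp hp).1
  · intro t ht x
    exact image_eq_zero_of_notMem_tsupport fun hp => ht ⟨_, hp, rfl⟩

theorem IsTest.exists_radius (h : IsTest W Θ) : ∃ R : ℝ, ∀ t x, R < ‖x‖ → Θ (t, x) = 0 := by
  obtain ⟨R, hR⟩ := (h.compact.isCompact.image continuous_snd).isBounded.exists_norm_le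
  refine ⟨R, fun t x hx => image_eq_zero_of_notMem_tsupport fun hp => ?_⟩
  exact absurd (hR x ⟨_, hp, rfl⟩) (not_le.2 hx)

/-- The amplitude `σ(t, x, 2πξ) φ(t, x)`. -/
def pdoAmplitude (σ : ℝ → E n → E n → ℂ) (φ : ℝ × E n → ℂ) (t : ℝ) (x ξ : E n) : ℂ :=
  σ t x ((2 * Real.pi) • ξ) * φ (t, x)

theorem isAmplitude_pdoAmplitude {I J : Set ℝ} {σ : ℝ → E n → E n → ℂ} (hσ : IsSymbolZero I σ)
    (hI : IsOpen I) (hJ : IsCompact J) (hJI : J ⊆ I) {φ : ℝ × E n → ℂ} (hφ : IsTest W φ) :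
    ∃ R, IsAmplitude R (fun t : J => pdoAmplitude σ φ t) := by
  obtain ⟨R, hR⟩ := hφ.exists_radius
  refine ⟨R, ?_⟩
  let M : ℂ →L[ℝ] ℂ →L[ℝ] ℂ := (ContinuousLinearMap.mul ℝ ℂ).flip
  refine ((hσ.isSymbolFamily hI hJ hJI).comp_smul (2 * Real.pi)).clm_apply (R := R)
    (m := fun t x => M (φ ((t : ℝ), x))) (fun t => ?_) (fun k => ?_) ?_
  · exact M.contDiff.comp (hφ.contDiff_slice t)
  · obtain ⟨C, hC⟩ := hφ.exists_bound_slice 0 k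
    refine ⟨‖M‖ * C, fun t x _ => ?_⟩
    refine (M.norm_iteratedFDeriv_comp_left (hφ.contDiff_slice t).contDiffAt
      (by exact_mod_cast le_top)).trans ?_
    gcongr
    simpa using hC t x
  · intro t x ξ hx
    simp [hR t x hx]

/-- The integrand is known to be jointly continuous only for `t ∈ I`. Extension by zero off this
open set is measurable, and integration in `x` preserves measurability. -/
theorem stronglyMeasurable_osc_pdoAmplitude {I : Set ℝ} {σ : ℝ → E n → E n → ℂ}
    (hσ : IsSymbolZero I σ) (hI : IsOpen I) {φ : ℝ × E n → ℂ} (hφ : IsTest W φ) :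
    ∃ H : ℝ × E n → ℂ, StronglyMeasurable H ∧
      ∀ t ∈ I, ∀ ξ, osc (pdoAmplitude σ φ t) ξ = H (t, ξ) := by
  let g : (ℝ × E n) × E n → ℂ := fun q =>
    Complex.exp (↑(2 * Real.pi * inner ℝ q.2 q.1.2) * Complex.I) •
      pdoAmplitude σ φ q.1.1 q.2 q.1.2
  let D : Set ((ℝ × E n) × E n) := {q | q.1.1 ∈ I}
  have hD : IsOpen D := hI.preimage (continuous_fst.comp continuous_fst)
  have hg : ContinuousOn g D := by
    have h1 : ContinuousOn (fun q : (ℝ × E n) × E n => σ q.1.1 q.2 ((2 * Real.pi) • q.1.2)) D :=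
      hσ.smooth.continuousOn.comp
        (f := fun q : (ℝ × E n) × E n => (q.1.1, q.2, (2 * Real.pi) • q.1.2))
        (by fun_prop) fun q hq => ⟨hq, trivial⟩
    have h2 : Continuous fun q : (ℝ × E n) × E n => φ (q.1.1, q.2) :=
      hφ.smooth.continuous.comp (by fun_prop)
    have h3 : Continuous fun q : (ℝ × E n) × E n =>
        Complex.exp (↑(2 * Real.pi * inner ℝ q.2 q.1.2) * Complex.I) := by fun_prop
    exact h3.continuousOn.smul (h1.mul h2.continuousOn)
  have hm : StronglyMeasurable (D.indicator g) := by
    classical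
    rw [← piecewise_eq_indicator]
    exact (hg.measurable_piecewise continuousOn_const hD.measurableSet).stronglyMeasurable
  refine ⟨fun p => ∫ x, D.indicator g (p, x), hm.integral_prod_right', fun t ht ξ => ?_⟩
  rw [osc, Real.fourierInv_eq']
  congr 1 with x
  rw [indicator_of_mem (show ((t, ξ), x) ∈ D from ht)]

/-- The transpose of the zero order term maps a test function to a bounded, weakly measurable family
of Schwartz functions. -/
theorem exists_family_transpose {I : Set ℝ} (hI : IsOpen I) {b : ZeroTerm n} (hb : b.Admissible I)
    {φ : ℝ × E n → ℂ} (hφ : IsTest (cyl I univ) φ) :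
    ∃ Ψ : ℝ → 𝓢(E n, ℂ), (∀ t ∈ I, ⇑(Ψ t) = b.transpose t (fun x => φ (t, x))) ∧
      BoundedFamily I Ψ ∧ WeaklyMeasurableFamily I Ψ := by
  cases b with
  | mul b =>
    have h := hφ.mul_left (hI.prod isOpen_univ) hb
    exact ⟨h.slice, fun t _ => rfl, h.boundedFamily_slice I,
      h.weaklyMeasurableFamily_slice hI.measurableSet⟩
  | pdo σ =>
    classical
    obtain ⟨J, hJ, hJI, hJ0⟩ := hφ.exists_compact_time
    obtain ⟨R, hR⟩ := isAmplitude_pdoAmplitude hb hI hJ hJI hφ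
    -- The uniform symbol bounds are available only for `t` in the compact set `J`; for other times
    -- `φ(t, ·)` is zero and so is the oscillatory integral, which makes the default value `0`
    -- correct.
    let G : ℝ → 𝓢(E n, ℂ) := fun t => if ht : t ∈ J then
      { toFun := osc (pdoAmplitude σ φ t)
        smooth' := hR.contDiff_osc ⟨t, ht⟩
        decay' := fun k m =>
          let ⟨C, hC⟩ := hR.exists_bound_osc k m
          ⟨C, fun ξ => hC ⟨t, ht⟩ ξ⟩ } else 0
    have hG0 : ∀ t ∉ J, G t = 0 := fun t ht => dif_neg ht
    have hosc0 : ∀ t ∉ J, osc (pdoAmplitude σ φ t) = fun _ => 0 := by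
      intro t ht
      ext1 ξ
      rw [osc, Real.fourierInv_eq']
      simp [pdoAmplitude, hJ0 t ht]
    have hG : ∀ t, ⇑(G t) = osc (pdoAmplitude σ φ t) := by
      intro t
      by_cases ht : t ∈ J
      · simp only [G, dif_pos ht]; rfl
      · rw [hG0 t ht, hosc0 t ht]; rfl
    have hGb : BoundedFamily I G := by
      refine BoundedFamily.zero_of_notMem (J := J) (fun k m => ?_) hG0
      obtain ⟨C, hC⟩ := hR.exists_bound_osc k m
      refine ⟨C, fun t ht ξ => ?_⟩
      rw [hG t]
      exact hC ⟨t, ht⟩ ξ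
    obtain ⟨H, hH, hH'⟩ := stronglyMeasurable_osc_pdoAmplitude hb hI hφ
    have hGm : WeaklyMeasurableFamily I G :=
      weaklyMeasurableFamily_of_stronglyMeasurable hH hI.measurableSet fun t ht ξ => by
        rw [hG t]; exact hH' t ht ξ
    refine ⟨fun t => 𝓕 (G t), fun t _ => ?_, hGb.fourier, hGm.fourier⟩
    rw [SchwartzMap.fourier_coe, hG t]
    rfl

/-- The zero order term acts in `x` alone. With `c = χ(t)` this says that it produces no commutator
with the cutoff. -/
theorem transpose_const_mul (b : ZeroTerm n) (t : ℝ) (c : ℂ) (g : E n → ℂ) :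
    b.transpose t (fun x => c * g x) = fun x => c * b.transpose t g x := by
  cases b with
  | mul b => ext x; simp only [ZeroTerm.transpose]; ring
  | pdo σ =>
    have h1 : ∀ ξ, 𝓕⁻ (fun x => σ t x ((2 * Real.pi) • ξ) * (c * g x)) ξ =
        c * 𝓕⁻ (fun x => σ t x ((2 * Real.pi) • ξ) * g x) ξ := by
      intro ξ
      rw [Real.fourierInv_eq', Real.fourierInv_eq', ← integral_const_mul]
      congr 1 with x
      simp only [smul_eq_mul]
      ring
    ext y
    simp only [ZeroTerm.transpose, pdoTranspose, h1]
    rw [Real.fourier_eq', Real.fourier_eq', ← integral_const_mul]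
    congr 1 with x
    simp only [smul_eq_mul]
    ring

theorem ContinuousSobolev.integrableSobolev {I J : Set ℝ} {s₁ s₂ : ℝ} {f : ℝ → 𝓢'(E n, ℂ)}
    (hf : ContinuousSobolev I s₁ s₂ f) (hJ : IsCompact J) (hJI : J ⊆ I) :
    IntegrableSobolev J s₁ s₂ f := by
  obtain ⟨g, hg, hfg⟩ := hf
  refine ⟨g, (hg.mono hJI).integrableOn_compact hJ, ?_⟩
  filter_upwards [ae_restrict_mem hJ.measurableSet] with t ht
  exact hfg t (hJI ht)

/-- The pairing of a continuous curve with a test function is integrable. -/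
theorem ContinuousSobolev.integrable_pair {I : Set ℝ} {s₁ s₂ : ℝ}
    {f : ℝ → 𝓢'(E n, ℂ)} (hf : ContinuousSobolev I s₁ s₂ f) (h : IsTest (cyl I univ) Θ) :
    Integrable (fun t => pair (f t) (fun x => Θ (t, x))) := by
  -- A continuous curve on an open interval may be unbounded at the ends; the test function confines
  -- the pairing to a compact set of times.
  obtain ⟨J, hJ, hJI, hJ0⟩ := h.exists_compact_time
  have h1 := integrableOn_pairing hJ.measurableSet (hf.integrableSobolev hJ hJI)
    (h.boundedFamily_slice J) (h.weaklyMeasurableFamily_slice hJ.measurableSet)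
  have h2 : (fun t => pair (f t) (fun x => Θ (t, x))) = fun t => f t (h.slice t) := by
    ext1 t
    exact pair_eq (h.coe_slice t)
  rw [h2, ← integrableOn_univ]
  refine IntegrableOn.of_forall_sdiff_eq_zero h1 MeasurableSet.univ fun t ht => ?_
  have : h.slice t = 0 := by
    ext x
    exact hJ0 t ht.2 x
  rw [this, map_zero]

/-- The weak form of the equation on one side of `t = 0`, for curves. -/
theorem integral_pair_eq_of_flux {δ : ℝ} {a : ℝ × E n → ℂ} {A : Fin n → ℝ × E n → ℂ}
    (ha : ContDiffOn ℝ ∞ a (cyl (Ioo (-δ) δ) univ))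
    (hA : ∀ j, ContDiffOn ℝ ∞ (A j) (cyl (Ioo (-δ) δ) univ))
    {I : Set ℝ} (hI : IsOpen I) (hIδ : I ⊆ Ioo (-δ) δ) {s : ℝ} (hs : |s| = 1)
    (hIs : ∀ t ∈ I, 0 < s * t) (hsI : ∀ t ∈ Ioo (-δ) δ, 0 < s * t → t ∈ I) {s₁ s₂ : ℝ}
    {b : ZeroTerm n} (hb : b.Admissible (Ioo (-δ) δ)) {f u : ℝ → 𝓢'(E n, ℂ)}
    (hf : ContinuousSobolev (Ioo (-δ) δ) s₁ s₂ f) (heq : IsDistSolCurve I a A b f u)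
    (hu : IntegrableSobolev I s₁ s₂ u)
    (hflux : ∀ φ : ℝ × E n → ℂ, IsTest (cyl (Ioo (-δ) δ) univ) φ →
        Tendsto (fun t : ℝ => pair (u t) (fun x => a (t, x) * φ (t, x))) (𝓝[I] 0) (𝓝 0))
    {φ : ℝ × E n → ℂ} (hφ : IsTest (cyl (Ioo (-δ) δ) univ) φ) :
    IntegrableOn (fun t => pair (u t) (fun x => vfTranspose a A φ (t, x)) +
        pair (u t) (b.transpose t (fun x => φ (t, x)))) I ∧
    ∫ t in I, (pair (u t) (fun x => vfTranspose a A φ (t, x)) +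
        pair (u t) (b.transpose t (fun x => φ (t, x)))) =
      ∫ t in I, pair (f t) (fun x => φ (t, x)) := by
  have hW : IsOpen (cyl (Ioo (-δ) δ) (univ : Set (E n))) := isOpen_Ioo.prod isOpen_univ
  have hX := hφ.vfTranspose hW ha hA
  have hB := hφ.mul_left hW ha
  obtain ⟨Ψ, hΨ, hΨb, hΨm⟩ := exists_family_transpose isOpen_Ioo hb hφ
  have slice_int : ∀ {Θ : ℝ × E n → ℂ}, IsTest (cyl (Ioo (-δ) δ) univ) Θ →
      IntegrableOn (fun t => pair (u t) (fun x => Θ (t, x))) I := by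
    intro Θ hΘ
    simpa only [pair_eq (hΘ.coe_slice _)] using integrableOn_pairing hI.measurableSet hu
      (hΘ.boundedFamily_slice I) (hΘ.weaklyMeasurableFamily_slice hI.measurableSet)
  have iB : IntegrableOn (fun t => pair (u t) (b.transpose t (fun x => φ (t, x)))) I := by
    refine (integrableOn_pairing hI.measurableSet hu (hΨb.mono hIδ) (hΨm.mono hIδ)).congr_fun
      (fun t ht => ?_) hI.measurableSet
    exact (pair_eq (hΨ t (hIδ ht))).symm
  have hP := (slice_int hX).add iB
  refine ⟨hP, ?_⟩
  refine integral_eq_of_cutoff hI.measurableSet hs hIs hP (hf.integrable_pair hφ).integrableOn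
    (slice_int hB) (hflux φ hφ) ?_
  intro χ hχ hχ0
  have hweak := heq _ (hφ.mul_time_of_supp hsI hχ hχ0)
  refine Eq.trans (setIntegral_congr_fun hI.measurableSet fun t ht => ?_)
    (hweak.trans (setIntegral_congr_fun hI.measurableSet fun t _ => ?_))
  · simp only
    -- The commutator formula is read as an identity of Schwartz functions at fixed `t`, so that
    -- linearity of `u t` splits off the flux term.
    have e1 : ⇑((χ t : ℂ) • hX.slice t - ((deriv χ t : ℝ) : ℂ) • hB.slice t) =
        fun x => vfTranspose a A (fun q => (χ q.1 : ℂ) * φ q) (t, x) := by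
      ext x
      rw [vfTranspose_mul_time hφ hW ha hA hχ]
      rfl
    have e2 : ⇑((χ t : ℂ) • Ψ t) = b.transpose t (fun x => (χ t : ℂ) * φ (t, x)) := by
      rw [transpose_const_mul, ← hΨ t (hIδ ht)]
      rfl
    rw [pair_eq e1, pair_eq e2, pair_eq (hX.coe_slice t), pair_eq (hB.coe_slice t),
      pair_eq (hΨ t (hIδ ht)), map_sub, map_smul, map_smul, map_smul]
    simp only [smul_eq_mul]
    ring
  · simp only
    rw [pair_eq (hφ.coe_slice t),
      pair_eq (ψ := (χ t : ℂ) • hφ.slice t) (g := fun x => (χ t : ℂ) * φ (t, x)) rfl, map_smul, smul_eq_mul]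

theorem glueDist_eq_left {up um : ℝ → 𝓢'(E n, ℂ)} {t : ℝ} (ht : 0 < t) :
    glueDist up um t = up t := by
  simp [glueDist, ht]

theorem glueDist_eq_right {up um : ℝ → 𝓢'(E n, ℂ)} {t : ℝ} (ht : t < 0) :
    glueDist up um t = um t := by
  simp [glueDist, ht, ht.le]

theorem integrableSobolev_glueDist {δ s₁ s₂ : ℝ} {up um : ℝ → 𝓢'(E n, ℂ)}
    (hp : IntegrableSobolev (Ioo 0 δ) s₁ s₂ up) (hm : IntegrableSobolev (Ioo (-δ) 0) s₁ s₂ um) :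
    IntegrableSobolev (Ioo (-δ) δ) s₁ s₂ (glueDist up um) := by
  classical
  obtain ⟨gp, hgp, hup⟩ := hp
  obtain ⟨gm, hgm, hum⟩ := hm
  let g : ℝ → Lp ℂ 2 (volume : Measure (E n)) := fun t => if 0 < t then gp t else gm t
  have cp : ∀ t ∈ Ioo 0 δ, gp t = g t := fun t ht => (if_pos ht.1).symm
  have cm : ∀ t ∈ Ioo (-δ) 0, gm t = g t := fun t ht => (if_neg (not_lt.2 ht.2.le)).symm
  refine ⟨g, ?_, ?_⟩
  · exact ((hgp.congr_fun cp measurableSet_Ioo).union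
      (hgm.congr_fun cm measurableSet_Ioo)).congr_set_ae (Ioo_ae_eq_union δ)
  · rw [Measure.restrict_congr_set (Ioo_ae_eq_union δ), ae_restrict_union_iff]
    constructor
    · filter_upwards [hup, ae_restrict_mem measurableSet_Ioo] with t h ht
      rw [glueDist_eq_left ht.1, ← cp t ht]
      exact h
    · filter_upwards [hum, ae_restrict_mem measurableSet_Ioo] with t h ht
      rw [glueDist_eq_right ht.2, ← cm t ht]
      exact h

/-- Sum of the identities from `integral_pair_eq_of_flux` on the two sides; the integrability proved
there permits splitting the integral. -/
theorem isDistSolCurve_glueDist {δ : ℝ} (hδ : 0 < δ) {a : ℝ × E n → ℂ}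
    {A : Fin n → ℝ × E n → ℂ}
    (ha : ContDiffOn ℝ ∞ a (cyl (Ioo (-δ) δ) univ))
    (hA : ∀ j, ContDiffOn ℝ ∞ (A j) (cyl (Ioo (-δ) δ) univ)) {s₁ s₂ : ℝ}
    {b : ZeroTerm n} (hb : b.Admissible (Ioo (-δ) δ)) {f up um : ℝ → 𝓢'(E n, ℂ)}
    (hf : ContinuousSobolev (Ioo (-δ) δ) s₁ s₂ f)
    (eqp : IsDistSolCurve (Ioo 0 δ) a A b f up) (eqm : IsDistSolCurve (Ioo (-δ) 0) a A b f um)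
    (ip : IntegrableSobolev (Ioo 0 δ) s₁ s₂ up) (im : IntegrableSobolev (Ioo (-δ) 0) s₁ s₂ um)
    (fp : ∀ φ : ℝ × E n → ℂ, IsTest (cyl (Ioo (-δ) δ) univ) φ →
        Tendsto (fun t : ℝ => pair (up t) (fun x => a (t, x) * φ (t, x))) (𝓝[>] 0) (𝓝 0))
    (fm : ∀ φ : ℝ × E n → ℂ, IsTest (cyl (Ioo (-δ) δ) univ) φ →
        Tendsto (fun t : ℝ => pair (um t) (fun x => a (t, x) * φ (t, x))) (𝓝[<] 0) (𝓝 0)) :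
    IsDistSolCurve (Ioo (-δ) δ) a A b f (glueDist up um) := by
  intro φ hφ
  obtain ⟨jp, hp⟩ := integral_pair_eq_of_flux ha hA isOpen_Ioo
    (Ioo_subset_Ioo_left (by linarith)) (s := 1) (by simp) (fun t ht => by simpa using ht.1)
    (fun t ht h => ⟨by simpa using h, ht.2⟩) hb hf eqp ip
    (fun φ hφ => (fp φ hφ).mono_left (nhdsWithin_mono _ fun t ht => ht.1)) hφ
  obtain ⟨jm, hm⟩ := integral_pair_eq_of_flux ha hA isOpen_Ioo
    (Ioo_subset_Ioo_right hδ.le) (s := -1) (by simp) (fun t ht => by simpa using ht.2)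
    (fun t ht h => ⟨ht.1, by simpa using h⟩) hb hf eqm im
    (fun φ hφ => (fm φ hφ).mono_left (nhdsWithin_mono _ fun t ht => ht.2)) hφ
  let T : 𝓢'(E n, ℂ) → ℝ → ℂ := fun v t => pair v (fun x => vfTranspose a A φ (t, x)) +
        pair v (b.transpose t (fun x => φ (t, x)))
  have cp : ∀ t ∈ Ioo 0 δ, T (up t) t = T (glueDist up um t) t := fun t ht => by
    rw [glueDist_eq_left ht.1]
  have cm : ∀ t ∈ Ioo (-δ) 0, T (um t) t = T (glueDist up um t) t := fun t ht => by
    rw [glueDist_eq_right ht.2]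
  have hR := hf.integrable_pair hφ
  change ∫ t in Ioo (-δ) δ, T (glueDist up um t) t = _
  rw [setIntegral_congr_set (Ioo_ae_eq_union δ), setIntegral_congr_set (Ioo_ae_eq_union δ),
    setIntegral_union (disjoint_Ioo_zero δ) measurableSet_Ioo
      (jp.congr_fun cp measurableSet_Ioo) (jm.congr_fun cm measurableSet_Ioo),
    setIntegral_union (disjoint_Ioo_zero δ) measurableSet_Ioo hR.integrableOn hR.integrableOn,
    ← setIntegral_congr_fun measurableSet_Ioo cp, ← setIntegral_congr_fun measurableSet_Ioo cm]
  exact congrArg₂ (· + ·) hp hm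

end Curves

end Gluing

end

open Gluing in
theorem lemma3p2 {n : ℕ} {δ : ℝ} (hδ : 0 < δ) {Ω : Set (E n)} (hΩ : IsOpen Ω)
    (a : ℝ × E n → ℂ) (A : Fin n → ℝ × E n → ℂ)
    (ha : ContDiffOn ℝ ∞ a (cyl (Ioo (-δ) δ) Ω))
    (hA : ∀ j, ContDiffOn ℝ ∞ (A j) (cyl (Ioo (-δ) δ) Ω))
    (ha0 : ∀ x ∈ Ω, a (0, x) = 0) :
    -- smooth solutions on the two sides, with a smooth function `b`
    (∀ b f up um : ℝ × E n → ℂ,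
      ContDiffOn ℝ ∞ b (cyl (Ioo (-δ) δ) Ω) →
      ContDiffOn ℝ ∞ f (cyl (Ioo (-δ) δ) Ω) →
      ContDiffOn ℝ ∞ up (cyl (Ioo 0 δ) Ω) →
      ContDiffOn ℝ ∞ um (cyl (Ioo (-δ) 0) Ω) →
      (∀ p ∈ cyl (Ioo 0 δ) Ω, vf a A up p + b p * up p = f p) →
      (∀ p ∈ cyl (Ioo (-δ) 0) Ω, vf a A um p + b p * um p = f p) →
      (∀ K : Set (E n), IsCompact K → K ⊆ Ω → IntegrableOn up (cyl (Ioo 0 δ) K)) →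
      (∀ K : Set (E n), IsCompact K → K ⊆ Ω → IntegrableOn um (cyl (Ioo (-δ) 0) K)) →
      (∀ φ : ℝ × E n → ℂ, IsTest (cyl (Ioo (-δ) δ) Ω) φ →
        Tendsto (fun t : ℝ => ∫ x, a (t, x) * up (t, x) * φ (t, x)) (𝓝[>] 0) (𝓝 0)) →
      (∀ φ : ℝ × E n → ℂ, IsTest (cyl (Ioo (-δ) δ) Ω) φ →
        Tendsto (fun t : ℝ => ∫ x, a (t, x) * um (t, x) * φ (t, x)) (𝓝[<] 0) (𝓝 0)) →
      LocallyIntegrableOn (glue up um) (cyl (Ioo (-δ) δ) Ω) ∧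
      (∀ K : Set (E n), IsCompact K → K ⊆ Ω →
        IntegrableOn (glue up um) (cyl (Ioo (-δ) δ) K)) ∧
      IsDistSol (cyl (Ioo (-δ) δ) Ω) a A b f (glue up um)) ∧
    -- `H^{s₁,s₂}`-valued solutions on the two sides, with `b` smooth or of order zero in `x`
    (Ω = univ → ∀ (s₁ s₂ : ℝ) (b : ZeroTerm n) (f up um : ℝ → 𝓢'(E n, ℂ)),
      b.Admissible (Ioo (-δ) δ) →
      ContinuousSobolev (Ioo (-δ) δ) s₁ s₂ f →
      ContinuousSobolev (Ioo 0 δ) s₁ s₂ up →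
      ContinuousSobolev (Ioo (-δ) 0) s₁ s₂ um →
      IsDistSolCurve (Ioo 0 δ) a A b f up →
      IsDistSolCurve (Ioo (-δ) 0) a A b f um →
      IntegrableSobolev (Ioo 0 δ) s₁ s₂ up →
      IntegrableSobolev (Ioo (-δ) 0) s₁ s₂ um →
      (∀ φ : ℝ × E n → ℂ, IsTest (cyl (Ioo (-δ) δ) univ) φ →
        Tendsto (fun t : ℝ => pair (up t) (fun x => a (t, x) * φ (t, x))) (𝓝[>] 0) (𝓝 0)) →
      (∀ φ : ℝ × E n → ℂ, IsTest (cyl (Ioo (-δ) δ) univ) φ →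
        Tendsto (fun t : ℝ => pair (um t) (fun x => a (t, x) * φ (t, x))) (𝓝[<] 0) (𝓝 0)) →
      IntegrableSobolev (Ioo (-δ) δ) s₁ s₂ (glueDist up um) ∧
      IsDistSolCurve (Ioo (-δ) δ) a A b f (glueDist up um)) := by
  refine ⟨fun b f up um hb hf hup hum eqp eqm ip im fp fm => ?_, ?_⟩
  · have hint : ∀ K : Set (E n), IsCompact K → K ⊆ Ω →
        IntegrableOn (glue up um) (cyl (Ioo (-δ) δ) K) := fun K hK hKΩ =>
      integrableOn_glue hK.measurableSet (ip K hK hKΩ) (im K hK hKΩ)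
    exact ⟨locallyIntegrableOn_of_compact isOpen_Ioo hΩ hint, hint,
      isDistSol_glue hδ hΩ ha hA hb hf hup hum eqp eqm ip im fp fm⟩
  · rintro rfl s₁ s₂ b f up um hb hf - - eqp eqm ip im fp fm
    exact ⟨integrableSobolev_glueDist ip im,
      isDistSolCurve_glueDist hδ ha hA hb hf eqp eqm ip im fp fm⟩
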